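/- Let $(\mathcal X^{(n)})_{n\ge 1}$ be an arbitrary sequence of nonempty sets (finite or infinite), $(\mathcal H^{(n)})_{n\ge1}$ an arbitrary sequence of complex Hilbert spaces (finite- or infinite-dimensional), and $\vec W=(W^{(n)})_{n\ge 1}$ an arbitrary sequence of maps (classical-quantum channels) $W^{(n)}:\mathcal X^{(n)}\to\mathcal S(\mathcal H^{(n)})$, $x\mapsto W^{(n)}_x$, where $\mathcal S(\mathcal H)$ is the set of density operators on $\mathcal H$; no relation between different $n$ is assumed. A code for $W^{(n)}$ is a triple $\Phi^{(n)}=(N,\varphi,Y)$ of an integer $N=|\Phi^{(n)}|\ge 1$, a map $\varphi:\{1,\dots,N\}\to\mathcal X^{(n)}$ and bounded operators $Y_1,\dots,Y_N\ge 0$ on $\mathcal H^{(n)}$ with $\sum_iY_i\le I$; its error probability is $P_e[\Phi^{(n)}]=\frac1N\sum_{i=1}^N\bigl(1-\mathrm{Tr}[W^{(n)}_{\varphi(i)}Y_i]\bigr)$. Define $$C(\vec W)=\sup\Bigl\{R\in\mathbb R:\ \exists\,(\Phi^{(n)})_n,\ \liminf_{n\to\infty}\tfrac1n\log|\Phi^{(n)}|\ge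 R\ \text{ and }\ \lim_{n\to\infty} P_e[\Phi^{(n)}]=0\Bigr\},$$ $$C^\dagger(\vec W)=\inf\Bigl\{R\in\mathbb R:\ \forall\,(\Phi^{(n)})_n,\ \liminf_{n\to\infty}\tfrac1n\log|\Phi^{(n)}|\ge R\ \text{ implies }\ \lim_{n\to\infty} P_e[\Phi^{(n)}]=1\Bigr\},$$ where $(\Phi^{(n)})_n$ ranges over the sequences of codes $\Phi^{(n)}$ for $W^{(n)}$. Let $\vec P=(P^{(n)})_n$ range over the sequences of finitely supported probability distributions $P^{(n)}$ on $\mathcal X^{(n)}$, and $\vec\sigma=(\sigma^{(n)})_n$ over the sequences of states $\sigma^{(n)}\in\mathcal S(\mathcal H^{(n)})$. For a self-adjoint trace-class operator $A$ let $\{A>0\}$ be the orthogonal projection onto the closed direct sum of the eigenspaces of $A$ with positive eigenvalues, and for $a\in\mathbb R$ put $$g_n(a)=\sum_{x\in\mathcal X^{(n)}}P^{(n)}(x)\,\mathrm{Tr}\bigl[W^{(n)}_x\{W^{(n)}_x-e^{na}\sigma^{(n)}>0\}\bigr].$$ Define $$\underline J(\vec P,\vec\sigma,\vec W)=\sup\{a\in\mathbb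 R:\lim_{n\to\infty} g_n(a)=1\},\qquad \overline J(\vec P,\vec\sigma,\vec W)=\inf\{a\in\mathbb R:\lim_{n\to\infty} g_n(a)=0\},$$ and let $\underline I(\vec P,\vec W)$ and $\overline I(\vec P,\vec W)$ be the values of $\underline J(\vec P,\vec\sigma,\vec W)$ and $\overline J(\vec P,\vec\sigma,\vec W)$ at $\sigma^{(n)}=W^{(n)}_{P^{(n)}}=\sum_xP^{(n)}(x)W^{(n)}_x$. All suprema and infima are taken in $[-\infty,\infty]$. Then $$C(\vec W)=\max_{\vec P}\underline I(\vec P,\vec W)=\max_{\vec P}\min_{\vec\sigma}\underline J(\vec P,\vec\sigma,\vec W),$$ $$C^\dagger(\vec W)=\max_{\vec P}\overline I(\vec P,\vec W)=\max_{\vec P}\min_{\vec\sigma}\overline J(\vec P,\vec\sigma,\vec W),$$ where all the maxima and minima are attained. -/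

import Mathlib

open Filter Topology

noncomputable section

namespace CQ

section Operators

variable {H : Type*} [NormedAddCommGroup H] [InnerProductSpace ℂ H] [CompleteSpace H]

/-- The index set of a fixed orthonormal (Hilbert) basis of `H`. -/
def basisIndex (H : Type*) [NormedAddCommGroup H] [InnerProductSpace ℂ H] [CompleteSpace H] :
    Set H :=
  (exists_hilbertBasis ℂ H).choose

/-- A fixed orthonormal (Hilbert) basis of `H`. -/
def basis (H : Type*) [NormedAddCommGroup H] [InnerProductSpace ℂ H] [CompleteSpace H] :
    HilbertBasis (basisIndex H) ℂ H :=
  (exists_hilbertBasis ℂ H).choose_spec.choose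

/-- The trace `Tr A = ∑ᵢ ⟨eᵢ, A eᵢ⟩`. For trace-class `A`, which is the only case in which it is
used below, the series converges absolutely and the value does not depend on the basis. -/
def tr (A : H →L[ℂ] H) : ℂ :=
  ∑' i, inner ℂ (basis H i) (A (basis H i))

/-- The spectral projection `{A > 0}` of a self-adjoint trace-class operator `A`: the orthogonal
projection onto the (closed) direct sum of the eigenspaces of `A` with positive eigenvalue. -/
def posProj (A : H →L[ℂ] H) : H →L[ℂ] H :=
  (⨆ (μ : ℝ) (_ : 0 < μ),
    Module.End.eigenspace (A : H →ₗ[ℂ] H) (μ : ℂ)).topologicalClosure.starProjection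

/-- `𝒮(H)`: the density operators on `H`, i.e. the positive trace-class operators of trace one
(a positive operator is trace class iff its trace series converges). -/
structure State (H : Type*) [NormedAddCommGroup H] [InnerProductSpace ℂ H]
    [CompleteSpace H] where
  op : H →L[ℂ] H
  isPositive : op.IsPositive
  hasSum_trace : HasSum (fun i => inner ℂ (basis H i) (op (basis H i))) (1 : ℂ)

/-- A classical-quantum channel `W : X → 𝒮(H)`. -/
abbrev Channel (X : Type*) (H : Type*) [NormedAddCommGroup H] [InnerProductSpace ℂ H]
    [CompleteSpace H] :=
  X → State H

/-- The mixture `W_P = ∑ₓ P(x) W_x`, where `P` is a finitely supported probability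
distribution on the input alphabet. -/
def mixture {X : Type*} (W : Channel X H) (P : Convexity.StdSimplex ℝ X) : State H where
  op := P.weights.sum fun x p => (p : ℂ) • (W x).op
  isPositive := by
    refine ContinuousLinearMap.isPositive_sum _ fun x _ => ?_
    exact (W x).isPositive.smul_of_nonneg (by exact_mod_cast P.nonneg x)
  hasSum_trace := by
    have h : HasSum (fun i => ∑ x ∈ P.weights.support,
        (P.weights x : ℂ) * inner ℂ (basis H i) ((W x).op (basis H i)))
        (∑ x ∈ P.weights.support, (P.weights x : ℂ) * 1) :=
      hasSum_sum fun x _ => (W x).hasSum_trace.mul_left _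
    have h1 : (∑ x ∈ P.weights.support, (P.weights x : ℂ) * 1) = 1 := by
      have := P.total
      rw [Finsupp.sum] at this
      simp only [mul_one]
      exact_mod_cast this
    rw [h1] at h
    convert h using 2 with i
    simp [Finsupp.sum, sum_apply]

/-- A code for the channel `W`: a size `N ≥ 1`, an encoder and a decoding POVM with
`∑ᵢ Yᵢ ≤ I`. -/
structure Code {X : Type*} (W : Channel X H) where
  size : ℕ
  size_pos : 0 < size
  enc : Fin size → X
  dec : Fin size → H →L[ℂ] H
  dec_isPositive : ∀ i, (dec i).IsPositive
  sum_dec_le : ∑ i, dec i ≤ 1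

/-- The average error probability `(1/N) ∑ᵢ (1 - Tr[W_{φ(i)} Yᵢ])`. -/
def Code.errorProb {X : Type*} {W : Channel X H} (Φ : Code W) : ℝ :=
  (1 / (Φ.size : ℝ)) * ∑ i, (1 - (tr ((W (Φ.enc i)).op * Φ.dec i)).re)

/-- `∑ₓ P(x) Tr[W_x {W_x - t σ > 0}]`. -/
def spectralMass {X : Type*} (W : Channel X H) (P : Convexity.StdSimplex ℝ X) (σ : State H)
    (t : ℝ) : ℝ :=
  P.weights.sum fun x p =>
    p * (tr ((W x).op * posProj ((W x).op - (t : ℂ) • σ.op))).re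

end Operators

section Sequences

variable {X : ℕ+ → Type*} {H : ℕ+ → Type*} [∀ n, NormedAddCommGroup (H n)]
  [∀ n, InnerProductSpace ℂ (H n)] [∀ n, CompleteSpace (H n)]

/-- `liminf (1/n) log |Φ⁽ⁿ⁾|`, as an extended real number. -/
def codeRate {W : ∀ n, Channel (X n) (H n)} (Φ : ∀ n, Code (W n)) : EReal :=
  liminf (fun n : ℕ+ => (((1 / ((n : ℕ) : ℝ)) * Real.log ((Φ n).size : ℝ) : ℝ) : EReal)) atTop

/-- The capacity `C(W)`. -/
def capacity (W : ∀ n, Channel (X n) (H n)) : EReal :=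
  sSup ((fun R : ℝ => (R : EReal)) '' {R : ℝ | ∃ Φ : ∀ n, Code (W n),
    (R : EReal) ≤ codeRate Φ ∧ Tendsto (fun n => (Φ n).errorProb) atTop (𝓝 0)})

/-- The dual (strong-converse) capacity `C†(W)`. -/
def dualCapacity (W : ∀ n, Channel (X n) (H n)) : EReal :=
  sInf ((fun R : ℝ => (R : EReal)) '' {R : ℝ | ∀ Φ : ∀ n, Code (W n),
    (R : EReal) ≤ codeRate Φ → Tendsto (fun n => (Φ n).errorProb) atTop (𝓝 1)})

/-- The quantity `J̲(P, σ, W)`. -/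
def infJ (P : ∀ n, Convexity.StdSimplex ℝ (X n)) (σ : ∀ n, State (H n))
    (W : ∀ n, Channel (X n) (H n)) : EReal :=
  sSup ((fun a : ℝ => (a : EReal)) '' {a : ℝ | Tendsto
    (fun n : ℕ+ => spectralMass (W n) (P n) (σ n) (Real.exp (((n : ℕ) : ℝ) * a))) atTop (𝓝 1)})

/-- The quantity `J̅(P, σ, W)`. -/
def supJ (P : ∀ n, Convexity.StdSimplex ℝ (X n)) (σ : ∀ n, State (H n))
    (W : ∀ n, Channel (X n) (H n)) : EReal :=
  sInf ((fun a : ℝ => (a : EReal)) '' {a : ℝ | Tendsto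
    (fun n : ℕ+ => spectralMass (W n) (P n) (σ n) (Real.exp (((n : ℕ) : ℝ) * a))) atTop (𝓝 0)})

/-- The quantum spectral inf-information rate `I̲(P, W)`. -/
def infI (P : ∀ n, Convexity.StdSimplex ℝ (X n)) (W : ∀ n, Channel (X n) (H n)) : EReal :=
  infJ P (fun n => mixture (W n) (P n)) W

/-- The quantum spectral sup-information rate `I̅(P, W)`. -/
def supI (P : ∀ n, Convexity.StdSimplex ℝ (X n)) (W : ∀ n, Channel (X n) (H n)) : EReal :=
  supJ P (fun n => mixture (W n) (P n)) W

end Sequences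

end CQ

end

/-! Everything rests on the tests `{W_x - tσ > 0}`. Density operators are compact, so `W_x - tσ` has
an eigenbasis, and comparing eigenvector by eigenvector shows that this test maximises `Tr[W_x Y] -
t Tr[σ Y]` over `0 ≤ Y ≤ 1` (`State.expect_sub_le_posProj`). Two one-shot bounds follow.

Converse (`Code.one_sub_errorProb_le`): comparing each decoder `Y_i` with the test and using `∑ Tr[σ
Y_i] ≤ 1`, the success probability is at most the spectral mass of the codeword law plus `t / N`,
for every `σ`. Direct part (`exists_code`): random codewords with a square-root measurement have
error at most `(1 + c)(1 - mass)` plus a term of order `(N - 1) / t + ε`. The value `c = 1` is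
enough for `C`; for `C†` an error near 1 must force the mass near 0, which needs `c → 0`.

At `t = e^{na}` the direct part bounds `I̲(P)` by `C` and `I̅(P)` by `C†`, for every `P`. The
converse yields a `P`, chosen before `σ`, with `C ≤ J̲(P, σ)` for all `σ`, and likewise for `C†`.
Since `I` is `J` at one particular `σ`, all the quantities coincide.

Attainment comes from mixing. For `C`, a diagonal sequence of codes reaches the supremum. For `C†`,
`P` is a geometric mixture of the laws of codes at rational rates below `C†`, so each component
keeps a weight bounded below. For the inner minimum, `σ⁽ⁿ⁾` is the uniform mixture of the first `n`
terms of a minimising sequence; the lost factor `1/n` is invisible on the exponential scale. -/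

noncomputable section

universe u

namespace CQ

/-! ### Hilbert–Schmidt sums and cyclicity of the trace -/

section HilbertSchmidt

variable {H : Type*} [NormedAddCommGroup H] [InnerProductSpace ℂ H]
  {ι κ : Type*}

lemma hasSum_sq_norm_inner (e : HilbertBasis ι ℂ H) (x : H) :
    HasSum (fun i => ‖inner ℂ (e i) x‖ ^ 2) (‖x‖ ^ 2) := by
  have h := Complex.hasSum_re (e.hasSum_inner_mul_inner x x)
  have h1 : (inner ℂ x x : ℂ).re = ‖x‖ ^ 2 := by
    simpa using inner_self_eq_norm_sq (𝕜 := ℂ) x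
  rw [h1] at h
  convert! h using 2 with i
  rw [← inner_conj_symm x (e i), ← Complex.normSq_eq_conj_mul_self, Complex.ofReal_re,
    Complex.normSq_eq_norm_sq]

lemma summable_sq_norm_inner_prod (e : HilbertBasis ι ℂ H) {x : κ → H}
    (hx : Summable fun k => ‖x k‖ ^ 2) :
    Summable fun p : κ × ι => ‖inner ℂ (e p.2) (x p.1)‖ ^ 2 := by
  rw [summable_prod_of_nonneg (fun _ => by positivity)]
  refine ⟨fun k => (hasSum_sq_norm_inner e (x k)).summable, ?_⟩
  simpa only [(hasSum_sq_norm_inner e (x _)).tsum_eq] using hx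

lemma summable_inner_mul_inner_prod (e : HilbertBasis ι ℂ H) {x y : κ → H}
    (hx : Summable fun k => ‖x k‖ ^ 2) (hy : Summable fun k => ‖y k‖ ^ 2) :
    Summable fun p : κ × ι => inner ℂ (x p.1) (e p.2) * inner ℂ (e p.2) (y p.1) := by
  refine Summable.of_norm_bounded
    ((summable_sq_norm_inner_prod e hx).add (summable_sq_norm_inner_prod e hy)) fun p => ?_
  rw [norm_mul, norm_inner_symm]
  have h1 := sq_nonneg (‖inner ℂ (e p.2) (x p.1)‖ - ‖inner ℂ (e p.2) (y p.1)‖)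
  have h2 := mul_nonneg (norm_nonneg (inner ℂ (e p.2) (x p.1)))
    (norm_nonneg (inner ℂ (e p.2) (y p.1)))
  linarith

/-- Fubini for a summable double family, in the form behind cyclicity and basis independence of the
trace. -/
lemma hasSum_comm_of_summable_prod {F : κ × ι → ℂ} (hF : Summable F) {r : κ → ℂ} {c : ι → ℂ}
    (hr : ∀ k, HasSum (fun i => F (k, i)) (r k)) (hc : ∀ i, HasSum (fun k => F (k, i)) (c i)) :
    ∃ a, HasSum r a ∧ HasSum c a := by
  have h2 : HasSum (fun p : ι × κ => F p.swap) (∑' p, F p) :=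
    (Equiv.prodComm ι κ).hasSum_iff.mpr hF.hasSum
  exact ⟨∑' p, F p, hF.hasSum.prod_fiberwise hr, h2.prod_fiberwise hc⟩

lemma isCompactOperator_rankOne (u v : H) :
    IsCompactOperator (InnerProductSpace.rankOne ℂ u v : H →L[ℂ] H) := by
  have h : IsCompactOperator (ContinuousLinearMap.toSpanSingleton ℂ u : ℂ →L[ℂ] H) :=
    isCompactOperator_of_locallyCompactSpace_rng _
  exact h.comp_clm (innerSL ℂ v)

lemma isClosed_eigenspace (A : H →L[ℂ] H) (μ : ℂ) :
    IsClosed (Module.End.eigenspace (A : H →ₗ[ℂ] H) μ : Set H) := by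
  have : (Module.End.eigenspace (A : H →ₗ[ℂ] H) μ : Set H) = {x | A x = μ • x} := by
    ext x; simp
  rw [this]
  exact isClosed_eq A.continuous (continuous_const_smul μ)

variable [CompleteSpace H]

/-- The Hilbert–Schmidt condition passes to the adjoint, for any two orthonormal bases. -/
lemma summable_adjoint (e : HilbertBasis ι ℂ H) (f : HilbertBasis κ ℂ H) {T : H →L[ℂ] H}
    (hT : Summable fun i => ‖T (e i)‖ ^ 2) :
    Summable fun k => ‖ContinuousLinearMap.adjoint T (f k)‖ ^ 2 := by
  have h := (summable_sq_norm_inner_prod f hT).prod_symm.prod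
  convert! h using 2 with k
  rw [← (hasSum_sq_norm_inner e _).tsum_eq]
  refine tsum_congr fun i => ?_
  rw [ContinuousLinearMap.adjoint_inner_right, norm_inner_symm]
  rfl

/-- Passing to adjoints moves `B` to the left, where its norm bounds each term; passing back allows
a change of basis. -/
lemma summable_comp (e : HilbertBasis ι ℂ H) {T : H →L[ℂ] H} (B : H →L[ℂ] H)
    (hT : Summable fun i => ‖T (e i)‖ ^ 2) (f : HilbertBasis κ ℂ H) :
    Summable fun k => ‖(T * B) (f k)‖ ^ 2 := by
  have h1 := summable_adjoint e e hT
  have h2 : Summable fun i => ‖ContinuousLinearMap.adjoint (T * B) (e i)‖ ^ 2 := by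
    refine Summable.of_nonneg_of_le (fun _ => by positivity) (fun i => ?_)
      (h1.mul_left (‖ContinuousLinearMap.adjoint B‖ ^ 2))
    rw [← mul_pow]
    gcongr
    have : ContinuousLinearMap.adjoint (T * B) (e i) =
        ContinuousLinearMap.adjoint B (ContinuousLinearMap.adjoint T (e i)) := by
      change star (T * B) (e i) = star B (star T (e i))
      rw [star_mul]; rfl
    rw [this]
    exact ContinuousLinearMap.le_opNorm _ _
  simpa using summable_adjoint e f h2

/-- Cyclicity `Tr (S T) = Tr (T S)` for Hilbert–Schmidt operators, computed in two bases. -/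
lemma hasSum_inner_adjoint_comm (e : HilbertBasis ι ℂ H) (f : HilbertBasis κ ℂ H)
    {S T : H →L[ℂ] H} (hS : Summable fun i => ‖S (e i)‖ ^ 2)
    (hT : Summable fun k => ‖T (f k)‖ ^ 2) :
    ∃ a : ℂ, HasSum (fun k => inner ℂ (ContinuousLinearMap.adjoint S (f k)) (T (f k))) a ∧
      HasSum (fun i => inner ℂ (ContinuousLinearMap.adjoint T (e i)) (S (e i))) a := by
  have hF := summable_inner_mul_inner_prod (x := fun k => ContinuousLinearMap.adjoint S (f k))
    (y := fun k => T (f k)) e (summable_adjoint e f hS) hT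
  refine hasSum_comm_of_summable_prod hF
    (fun k => e.hasSum_inner_mul_inner (ContinuousLinearMap.adjoint S (f k)) (T (f k)))
    (fun i => ?_)
  have h := f.hasSum_inner_mul_inner (ContinuousLinearMap.adjoint T (e i)) (S (e i))
  refine h.congr_fun fun k => ?_
  simp only [ContinuousLinearMap.adjoint_inner_left]
  exact mul_comm _ _

end HilbertSchmidt

/-! ### Density operators, expectations and spectral tests -/

section States

variable {H : Type*} [NormedAddCommGroup H] [InnerProductSpace ℂ H] [CompleteSpace H]
  {ι : Type*}

namespace State

/-- The square root of a density operator. -/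
def sqrtOp (ρ : State H) : H →L[ℂ] H := CFC.sqrt ρ.op

lemma op_nonneg (ρ : State H) : 0 ≤ ρ.op :=
  (ContinuousLinearMap.nonneg_iff_isPositive _).mpr ρ.isPositive

lemma sqrtOp_mul_self (ρ : State H) : ρ.sqrtOp * ρ.sqrtOp = ρ.op :=
  CFC.sqrt_mul_sqrt_self ρ.op ρ.op_nonneg

lemma adjoint_sqrtOp (ρ : State H) : ContinuousLinearMap.adjoint ρ.sqrtOp = ρ.sqrtOp :=
  (IsSelfAdjoint.of_nonneg (CFC.sqrt_nonneg ρ.op)).star_eq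

lemma inner_sqrtOp (ρ : State H) (x y : H) :
    inner ℂ (ρ.sqrtOp x) (ρ.sqrtOp y) = inner ℂ x (ρ.op y) := by
  conv_lhs => rw [← ρ.adjoint_sqrtOp]
  rw [ContinuousLinearMap.adjoint_inner_left]
  conv_rhs => rw [← ρ.sqrtOp_mul_self]
  rw [ρ.adjoint_sqrtOp]
  rfl

lemma summable_sq_norm_sqrtOp (ρ : State H) :
    Summable fun i => ‖ρ.sqrtOp (basis H i)‖ ^ 2 := by
  have h := (Complex.hasSum_re ρ.hasSum_trace).summable
  convert! h using 2 with i
  rw [← ρ.inner_sqrtOp]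
  exact (inner_self_eq_norm_sq (𝕜 := ℂ) _).symm

/-- Cyclicity for the Hilbert–Schmidt pair `√ρ` and `√ρ B`. The symmetrised sum does not involve
`f`, so the trace is independent of the basis. -/
lemma exists_hasSum_inner (ρ : State H) (B : H →L[ℂ] H) (f : HilbertBasis ι ℂ H) :
    HasSum (fun k => inner ℂ (f k) (ρ.op (B (f k))))
      (∑' i, inner ℂ (ρ.sqrtOp (basis H i)) (B (ρ.sqrtOp (basis H i)))) ∧
    Summable fun i => inner ℂ (ρ.sqrtOp (basis H i)) (B (ρ.sqrtOp (basis H i))) := by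
  obtain ⟨a, h1, h2⟩ := hasSum_inner_adjoint_comm (basis H) f ρ.summable_sq_norm_sqrtOp
    (summable_comp (basis H) B ρ.summable_sq_norm_sqrtOp f)
  have h3 : HasSum (fun i => inner ℂ (ρ.sqrtOp (basis H i)) (B (ρ.sqrtOp (basis H i)))) a := by
    convert! h2 using 2 with i
    rw [ContinuousLinearMap.adjoint_inner_left]
    conv_lhs => rw [← ρ.adjoint_sqrtOp, ContinuousLinearMap.adjoint_inner_left, ρ.adjoint_sqrtOp]
    rfl
  refine ⟨?_, h3.summable⟩
  rw [h3.tsum_eq]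
  convert! h1 using 2 with k
  rw [ρ.adjoint_sqrtOp, ← inner_sqrtOp]
  rfl

/-- The expectation `Re Tr (ρ B)` of a bounded operator in a state. -/
def expect (ρ : State H) (B : H →L[ℂ] H) : ℝ := (tr (ρ.op * B)).re

/-- The trace of `ρ B` may be computed in any orthonormal basis. -/
lemma hasSum_inner_mul (ρ : State H) (B : H →L[ℂ] H) (f : HilbertBasis ι ℂ H) :
    HasSum (fun k => (inner ℂ (f k) (ρ.op (B (f k)))).re) (ρ.expect B) := by
  have h := (ρ.exists_hasSum_inner B (basis H)).1
  rw [expect, tr, show (∑' i, inner ℂ (basis H i) ((ρ.op * B) (basis H i))) = _ from h.tsum_eq]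
  exact Complex.hasSum_re (ρ.exists_hasSum_inner B f).1

/-- In this symmetrised form linearity and positivity in `B` can be read off term by term. -/
lemma hasSum_inner_sqrtOp (ρ : State H) (B : H →L[ℂ] H) :
    HasSum (fun i => (inner ℂ (ρ.sqrtOp (basis H i)) (B (ρ.sqrtOp (basis H i)))).re)
      (ρ.expect B) := by
  have h := ρ.exists_hasSum_inner B (basis H)
  rw [expect, tr, show (∑' i, inner ℂ (basis H i) ((ρ.op * B) (basis H i))) = _ from h.1.tsum_eq]
  exact Complex.hasSum_re h.2.hasSum

lemma expect_add (ρ : State H) (A B : H →L[ℂ] H) :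
    ρ.expect (A + B) = ρ.expect A + ρ.expect B := by
  refine (ρ.hasSum_inner_sqrtOp _).unique ?_
  simpa [inner_add_right] using (ρ.hasSum_inner_sqrtOp A).add (ρ.hasSum_inner_sqrtOp B)

lemma expect_smul (ρ : State H) (c : ℝ) (B : H →L[ℂ] H) :
    ρ.expect ((c : ℂ) • B) = c * ρ.expect B := by
  refine (ρ.hasSum_inner_sqrtOp _).unique ?_
  simpa [inner_smul_right] using (ρ.hasSum_inner_sqrtOp B).mul_left c

lemma expect_sub (ρ : State H) (A B : H →L[ℂ] H) :
    ρ.expect (A - B) = ρ.expect A - ρ.expect B := by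
  have := ρ.expect_add (A - B) B
  rw [sub_add_cancel] at this
  linarith

lemma expect_zero (ρ : State H) : ρ.expect 0 = 0 := by
  simpa using ρ.expect_sub 0 0

lemma expect_one (ρ : State H) : ρ.expect 1 = 1 := by
  rw [expect, tr, mul_one, ρ.hasSum_trace.tsum_eq, Complex.one_re]

lemma expect_sum (ρ : State H) {α : Type*} (s : Finset α) (B : α → H →L[ℂ] H) :
    ρ.expect (∑ a ∈ s, B a) = ∑ a ∈ s, ρ.expect (B a) :=
  map_sum (AddMonoidHom.mk' ρ.expect ρ.expect_add) B s

lemma expect_nonneg (ρ : State H) {B : H →L[ℂ] H} (hB : 0 ≤ B) : 0 ≤ ρ.expect B := by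
  rw [ContinuousLinearMap.nonneg_iff_isPositive] at hB
  exact (ρ.hasSum_inner_sqrtOp B).nonneg fun i => hB.re_inner_nonneg_right _

lemma expect_mono (ρ : State H) {A B : H →L[ℂ] H} (h : A ≤ B) : ρ.expect A ≤ ρ.expect B := by
  have := ρ.expect_nonneg (sub_nonneg.mpr h)
  rw [expect_sub] at this
  linarith

lemma expect_le_one (ρ : State H) {B : H →L[ℂ] H} (h : B ≤ 1) : ρ.expect B ≤ 1 :=
  (ρ.expect_mono h).trans_eq ρ.expect_one

/-- Only the coefficients outside `F` survive, and each equals `⟨√ρ eᵢ, x⟩`, to which Cauchy–Schwarz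
applies. The bound is uniform in `x` up to `‖x‖²`. -/
lemma norm_sub_sum_sq_le (ρ : State H) (F : Finset (basisIndex H)) (x : H) :
    ‖ρ.sqrtOp x - ∑ i ∈ F, inner ℂ (basis H i) (ρ.sqrtOp x) • basis H i‖ ^ 2 ≤
      (∑' i : {i // i ∉ F}, ‖ρ.sqrtOp (basis H i)‖ ^ 2) * ‖x‖ ^ 2 := by
  classical
  set y := ρ.sqrtOp x with hy
  have hinner : ∀ i, inner ℂ (basis H i) (y - ∑ i ∈ F, inner ℂ (basis H i) y • basis H i) =
      if i ∈ F then 0 else inner ℂ (basis H i) y := by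
    intro i
    rw [inner_sub_right]
    split_ifs with hi
    · rw [(basis H).orthonormal.inner_right_sum _ hi, sub_self]
    · rw [inner_sum, Finset.sum_eq_zero, sub_zero]
      intro j hj
      rw [inner_smul_right, (basis H).orthonormal.2 (fun h => hi (by rwa [h])), mul_zero]
  have h1 := hasSum_sq_norm_inner (basis H) (y - ∑ i ∈ F, inner ℂ (basis H i) y • basis H i)
  have hs := ρ.summable_sq_norm_sqrtOp
  have h2 : HasSum (fun i => if i ∈ F then 0 else ‖ρ.sqrtOp (basis H i)‖ ^ 2)
      (∑' i : {i // i ∉ F}, ‖ρ.sqrtOp (basis H i)‖ ^ 2) := by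
    have h3 : HasSum (fun i : ((F : Set (basisIndex H))ᶜ : Set _) =>
        ‖ρ.sqrtOp (basis H i)‖ ^ 2) (∑' i : {i // i ∉ F}, ‖ρ.sqrtOp (basis H i)‖ ^ 2) :=
      (hs.subtype _).hasSum
    have h4 := (hasSum_subtype_iff_indicator
      (f := fun i => ‖ρ.sqrtOp (basis H i)‖ ^ 2)).mp h3
    refine h4.congr_fun fun i => ?_
    by_cases hi : i ∈ F <;> simp [hi]
  refine hasSum_le (fun i => ?_) h1 (h2.mul_right (‖x‖ ^ 2))
  rw [hinner]
  split_ifs with hi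
  · simp
  · rw [← mul_pow, hy]
    conv_lhs => rw [← ρ.adjoint_sqrtOp, ContinuousLinearMap.adjoint_inner_right]
    gcongr
    exact norm_inner_le_norm _ _

/-- `√ρ` is the norm limit of its finite-rank truncations, since the tail of `∑ ‖√ρ eᵢ‖²` tends to
zero. -/
lemma isCompactOperator_op (ρ : State H) : IsCompactOperator ρ.op := by
  have key : IsCompactOperator ρ.sqrtOp := by
    let P : Finset (basisIndex H) → H →L[ℂ] H := fun F =>
      (∑ i ∈ F, InnerProductSpace.rankOne ℂ (basis H i) (basis H i)) * ρ.sqrtOp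
    have hP : ∀ F x, P F x = ∑ i ∈ F, inner ℂ (basis H i) (ρ.sqrtOp x) • basis H i := by
      intro F x
      simp [P, sum_apply]
    refine isCompactOperator_of_tendsto (l := atTop) (F := P) ?_ (Eventually.of_forall fun F => ?_)
    · rw [tendsto_iff_norm_sub_tendsto_zero]
      have h0 := tendsto_tsum_compl_atTop_zero fun i => ‖ρ.sqrtOp (basis H i)‖ ^ 2
      have h1 := (Real.continuous_sqrt.tendsto 0).comp h0
      rw [Real.sqrt_zero] at h1
      refine squeeze_zero (fun _ => norm_nonneg _) (fun F => ?_) h1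
      refine ContinuousLinearMap.opNorm_le_bound _ (Real.sqrt_nonneg _) fun x => ?_
      change ‖P F x - ρ.sqrtOp x‖ ≤ _
      rw [norm_sub_rev, hP]
      refine (pow_le_pow_iff_left₀ (norm_nonneg _)
        (mul_nonneg (Real.sqrt_nonneg _) (norm_nonneg _)) two_ne_zero).mp ?_
      rw [mul_pow]
      change _ ≤ √(∑' i : {i // i ∉ F}, ‖ρ.sqrtOp (basis H i)‖ ^ 2) ^ 2 * _
      rw [Real.sq_sqrt (tsum_nonneg fun _ => by positivity)]
      exact ρ.norm_sub_sum_sq_le F x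
    · have : IsCompactOperator (∑ i ∈ F, InnerProductSpace.rankOne ℂ (basis H i) (basis H i) :
          H →L[ℂ] H) :=
        Submodule.sum_mem (compactOperator (RingHom.id ℂ) H H)
          fun i _ => isCompactOperator_rankOne _ _
      exact this.comp_clm ρ.sqrtOp
  have h := key.comp_clm ρ.sqrtOp
  convert! h using 1
  conv_lhs => rw [← ρ.sqrtOp_mul_self]
  rfl

lemma expect_mixture {X : Type*} (W : Channel X H) (P : Convexity.StdSimplex ℝ X)
    (B : H →L[ℂ] H) :
    (mixture W P).expect B = P.weights.sum fun x p => p * (W x).expect B := by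
  have h : HasSum (fun k => ∑ x ∈ P.weights.support,
      P.weights x * (inner ℂ (basis H k) ((W x).op (B (basis H k)))).re)
      (∑ x ∈ P.weights.support, P.weights x * (W x).expect B) :=
    hasSum_sum fun x _ => ((W x).hasSum_inner_mul B (basis H)).mul_left _
  refine ((mixture W P).hasSum_inner_mul B (basis H)).unique (h.congr_fun fun k => ?_)
  simp [mixture, Finsupp.sum, sum_apply]

end State

/-- A complete orthogonal family of closed subspaces contains an orthonormal basis of vectors
taken from its members. -/
lemma exists_hilbertBasis_mem {H : Type u} [NormedAddCommGroup H] [InnerProductSpace ℂ H]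
    [CompleteSpace H] {α : Type} (V : α → Submodule ℂ H) [∀ a, CompleteSpace (V a)]
    (hV : OrthogonalFamily ℂ (fun a => V a) fun a => (V a).subtypeₗᵢ) (hd : (⨆ a, V a)ᗮ = ⊥) :
    ∃ (ι : Type u) (f : HilbertBasis ι ℂ H) (m : ι → α), ∀ i, f i ∈ V (m i) := by
  let v : (Σ a, basisIndex (V a)) → H := fun p => (basis (V p.1) p.2 : V p.1)
  have hv : Orthonormal ℂ v := hV.orthonormal_sigma_orthonormal fun a => (basis (V a)).orthonormal
  have hsp : (Submodule.span ℂ (Set.range v))ᗮ = ⊥ := by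
    rw [eq_bot_iff, ← hd]
    intro x hx
    rw [Submodule.mem_orthogonal'] at hx
    rw [← Submodule.iInf_orthogonal, Submodule.mem_iInf]
    intro a
    rw [Submodule.mem_orthogonal']
    intro u hu
    have h0 := (basis (V a)).hasSum_repr ⟨u, hu⟩
    have h1 := (h0.mapL (V a).subtypeL).mapL (innerSL ℂ x)
    refine h1.unique (hasSum_zero.congr_fun fun i => ?_)
    have h2 : inner ℂ x ((basis (V a) i : V a) : H) = 0 :=
      hx _ (Submodule.subset_span ⟨⟨a, i⟩, rfl⟩)
    simp [h2]
  refine ⟨_, HilbertBasis.mkOfOrthogonalEqBot hv hsp, fun p => p.1, fun p => ?_⟩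
  rw [HilbertBasis.coe_mkOfOrthogonalEqBot]
  exact (basis (V p.1) p.2).2

/-- A compact self-adjoint operator has an orthonormal basis of eigenvectors. -/
lemma exists_hilbertBasis_eigenvectors {H : Type u} [NormedAddCommGroup H]
    [InnerProductSpace ℂ H] [CompleteSpace H] {A : H →L[ℂ] H} (hA : IsCompactOperator A)
    (hs : A.IsSymmetric) :
    ∃ (ι : Type u) (f : HilbertBasis ι ℂ H) (l : ι → ℝ), ∀ i, A (f i) = (l i : ℂ) • f i := by
  have : ∀ μ : ℂ, CompleteSpace (Module.End.eigenspace (A : H →ₗ[ℂ] H) μ) :=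
    fun μ => (isClosed_eigenspace A μ).completeSpace_coe
  obtain ⟨ι, f, m, hf⟩ := exists_hilbertBasis_mem
    (fun μ : ℂ => Module.End.eigenspace (A : H →ₗ[ℂ] H) μ) hs.orthogonalFamily_eigenspaces
    (ContinuousLinearMap.orthogonalComplement_iSup_eigenspaces_eq_bot hA hs)
  refine ⟨ι, f, fun i => (m i).re, fun i => ?_⟩
  have hreal : ((m i).re : ℂ) = m i :=
    Complex.conj_eq_iff_re.mp (hs.conj_eigenvalue_eq_self
      (Module.End.hasEigenvalue_of_hasEigenvector ⟨hf i, f.orthonormal.ne_zero i⟩))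
  rw [hreal]
  exact Module.End.mem_eigenspace_iff.mp (hf i)

lemma posProj_apply_of_pos {A : H →L[ℂ] H} {x : H} {l : ℝ} (hx : A x = (l : ℂ) • x)
    (hl : 0 < l) : posProj A x = x := by
  refine Submodule.starProjection_eq_self_iff.mpr (Submodule.le_topologicalClosure _ ?_)
  exact Submodule.mem_iSup_of_mem l (Submodule.mem_iSup_of_mem hl
    (Module.End.mem_eigenspace_iff.mpr hx))

lemma posProj_apply_of_nonpos {A : H →L[ℂ] H} (hs : A.IsSymmetric) {x : H} {l : ℝ}
    (hx : A x = (l : ℂ) • x) (hl : l ≤ 0) : posProj A x = 0 := by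
  rw [posProj, Submodule.starProjection_apply_eq_zero_iff, Submodule.orthogonal_closure,
    ← Submodule.iInf_orthogonal, Submodule.mem_iInf]
  intro μ
  rw [Submodule.mem_orthogonal]
  intro u hu
  by_cases hμ : 0 < μ
  · rw [iSup_pos hμ] at hu
    have hne : (μ : ℂ) ≠ l := by exact_mod_cast (hl.trans_lt hμ).ne'
    exact hs.orthogonalFamily_eigenspaces hne ⟨u, hu⟩
      ⟨x, Module.End.mem_eigenspace_iff.mpr hx⟩
  · rw [iSup_neg hμ, Submodule.mem_bot] at hu
    rw [hu, inner_zero_left]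

lemma isStarProjection_posProj (A : H →L[ℂ] H) : IsStarProjection (posProj A) :=
  isStarProjection_starProjection

lemma posProj_nonneg (A : H →L[ℂ] H) : 0 ≤ posProj A := (isStarProjection_posProj A).nonneg

lemma posProj_le_one (A : H →L[ℂ] H) : posProj A ≤ 1 := (isStarProjection_posProj A).le_one

/-- Neyman–Pearson optimality of the test `{ρ - t σ > 0}`. -/
lemma State.expect_sub_le_posProj (ρ σ : State H) (t : ℝ) {Y : H →L[ℂ] H} (hY0 : 0 ≤ Y)
    (hY1 : Y ≤ 1) :
    ρ.expect Y - t * σ.expect Y ≤ ρ.expect (posProj (ρ.op - (t : ℂ) • σ.op)) -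
      t * σ.expect (posProj (ρ.op - (t : ℂ) • σ.op)) := by
  set A := ρ.op - (t : ℂ) • σ.op with hA
  have hs : A.IsSymmetric := by
    have : IsSelfAdjoint A := by
      refine ρ.isPositive.isSelfAdjoint.sub (IsSelfAdjoint.smul ?_ σ.isPositive.isSelfAdjoint)
      exact Complex.conj_ofReal t
    exact ContinuousLinearMap.isSelfAdjoint_iff_isSymmetric.mp this
  have hc : IsCompactOperator A :=
    ρ.isCompactOperator_op.sub (σ.isCompactOperator_op.smul (t : ℂ))
  obtain ⟨ι, f, l, hf⟩ := exists_hilbertBasis_eigenvectors hc hs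
  -- In the eigenbasis only the diagonal of `B` matters. It lies in `[0, 1]` for a test, so the best
  -- choice is 1 where the eigenvalue is positive and 0 elsewhere.
  have key : ∀ B : H →L[ℂ] H, HasSum (fun i => l i * (inner ℂ (f i) (B (f i))).re)
      (ρ.expect B - t * σ.expect B) := by
    intro B
    refine ((ρ.hasSum_inner_mul B f).sub ((σ.hasSum_inner_mul B f).mul_left t)).congr_fun
      fun i => ?_
    have h1 : inner ℂ (f i) (A (B (f i))) = (l i : ℂ) * inner ℂ (f i) (B (f i)) := by
      rw [← hs.apply_clm, hf, inner_smul_left, Complex.conj_ofReal]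
    have h2 := congrArg Complex.re h1
    rw [hA] at h2
    simp at h2
    linarith
  refine hasSum_le (fun i => ?_) (key Y) (key (posProj A))
  have hn : inner ℂ (f i) (f i) = (1 : ℂ) := by
    rw [inner_self_eq_norm_sq_to_K, f.orthonormal.1 i]; simp
  rcases lt_or_ge 0 (l i) with hl | hl
  · rw [posProj_apply_of_pos (hf i) hl, hn]
    refine mul_le_mul_of_nonneg_left ?_ hl.le
    have := ((ContinuousLinearMap.le_def _ _).mp hY1).re_inner_nonneg_right (f i)
    simpa [inner_sub_right, f.orthonormal.1 i] using this
  · rw [posProj_apply_of_nonpos hs (hf i) hl, inner_zero_right, Complex.zero_re, mul_zero]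
    rw [ContinuousLinearMap.nonneg_iff_isPositive] at hY0
    exact mul_nonpos_of_nonpos_of_nonneg hl (hY0.re_inner_nonneg_right (f i))

end States

/-! ### The Hayashi–Nagaoka inequality and the square-root measurement -/

section OperatorInequality

variable {H : Type*} [NormedAddCommGroup H] [InnerProductSpace ℂ H] [CompleteSpace H]

lemma State.expect_real_smul (ρ : State H) (c : ℝ) (B : H →L[ℂ] H) :
    ρ.expect (c • B) = c * ρ.expect B := by
  rw [← expect_smul, Complex.coe_smul]

/-- The Hayashi–Nagaoka operator inequality. -/
lemma one_sub_conj_le {S T R : H →L[ℂ] H} (hS : IsStarProjection S) (hT : 0 ≤ T)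
    (hR : IsSelfAdjoint R) (hRQ : R * CFC.sqrt (S + T) = 1) (hQR : CFC.sqrt (S + T) * R = 1)
    {c : ℝ} (hc : 0 < c) :
    1 - R * S * R ≤ (1 + c) • (1 - S) + (2 + c + c⁻¹) • T := by
  set Q := CFC.sqrt (S + T) with hQ
  have hQQ : Q * Q = S + T := CFC.sqrt_mul_sqrt_self _ (add_nonneg hS.nonneg hT)
  -- Operator monotonicity of the square root, with `√S = S` for a projection.
  have hSQ : S ≤ Q := by
    have h1 : CFC.sqrt S = S := by
      conv_lhs => rw [← hS.isIdempotentElem.eq]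
      exact CFC.sqrt_mul_self S hS.nonneg
    rw [← h1]
    exact CFC.sqrt_le_sqrt _ _ (le_add_of_nonneg_right hT)
  have hG : R * (S + T) * R = 1 := by
    rw [← hQQ, ← mul_assoc, hRQ, one_mul, hQR]
  have h1 : 1 - R * S * R = R * T * R := by
    rw [← hG]; noncomm_ring
  have hD : IsSelfAdjoint (R - 1) := hR.sub (.one _)
  -- Write `R = D + 1` with `D = R - 1`. The cross terms `DT + TD` are at most `c DTD + c⁻¹ T`,
  -- because `c (D - c⁻¹) T (D - c⁻¹) ≥ 0`.
  have h2 : R * T * R ≤ (1 + c) • ((R - 1) * T * (R - 1)) + (1 + c⁻¹) • T := by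
    have h := smul_nonneg hc.le
      ((hD.sub ((IsSelfAdjoint.all c⁻¹).smul (IsSelfAdjoint.one (H →L[ℂ] H)))).conjugate_nonneg hT)
    have e1 : c • ((R - 1 - c⁻¹ • 1) * T * (R - 1 - c⁻¹ • 1)) =
        c • ((R - 1) * T * (R - 1)) - (R - 1) * T - T * (R - 1) + c⁻¹ • T := by
      generalize R - 1 = D
      simp only [sub_mul, mul_sub, smul_mul_assoc, mul_smul_comm, one_mul, mul_one, smul_sub,
        smul_smul, mul_inv_cancel₀ hc.ne', mul_inv_cancel_left₀ hc.ne', one_smul]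
      abel
    have e2 : R * T * R = (R - 1) * T * (R - 1) + (R - 1) * T + T * (R - 1) + T := by
      noncomm_ring
    rw [e1] at h
    rw [← sub_nonneg, e2]
    convert! h using 1
    module
  have h3 : (R - 1) * T * (R - 1) ≤ 1 - (2 : ℝ) • S + (S + T) := by
    have h4 : (R - 1) * T * (R - 1) ≤ (R - 1) * (S + T) * (R - 1) := by
      have h := hD.conjugate_nonneg hS.nonneg
      rw [mul_add, add_mul]
      exact le_add_of_nonneg_left h
    have h5 : (R - 1) * (S + T) * (R - 1) = 1 - (2 : ℝ) • Q + (S + T) := by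
      have e1 : R * (S + T) = Q := by rw [← hQQ, ← mul_assoc, hRQ, one_mul]
      have e2 : (S + T) * R = Q := by rw [← hQQ, mul_assoc, hQR, mul_one]
      rw [sub_mul, mul_sub, sub_mul, hG, one_mul, e1, mul_one, e2, two_smul]
      abel
    rw [h5] at h4
    refine h4.trans ?_
    gcongr
  rw [h1]
  refine h2.trans ?_
  calc (1 + c) • ((R - 1) * T * (R - 1)) + (1 + c⁻¹) • T
      ≤ (1 + c) • (1 - (2 : ℝ) • S + (S + T)) + (1 + c⁻¹) • T := by gcongr
    _ = _ := by module

/-- A square-root measurement built from projections. -/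
lemma exists_decoder {N : ℕ} (p : Fin N → H →L[ℂ] H) (hp : ∀ i, IsStarProjection (p i))
    {c ε : ℝ} (hc : 0 < c) (hε : 0 < ε) :
    ∃ Y : Fin N → H →L[ℂ] H, (∀ i, 0 ≤ Y i) ∧ ∑ i, Y i ≤ 1 ∧
      ∀ i, 1 - Y i ≤ (1 + c) • (1 - p i) +
        (2 + c + c⁻¹) • (∑ j ∈ Finset.univ.erase i, p j + ε • (1 : H →L[ℂ] H)) := by
  set G := ∑ i, p i + ε • (1 : H →L[ℂ] H) with hG
  have hsum : ∀ s : Finset (Fin N), 0 ≤ ∑ i ∈ s, p i :=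
    fun s => Finset.sum_nonneg fun i _ => (hp i).nonneg
  have hε1 : (0 : H →L[ℂ] H) ≤ ε • 1 := smul_nonneg hε.le zero_le_one
  have hG0 : 0 ≤ G := add_nonneg (hsum _) hε1
  have hGu : IsUnit G := by
    refine CStarAlgebra.isUnit_of_le (ε • (1 : H →L[ℂ] H)) (le_add_of_nonneg_left (hsum _)) ?_
    rw [IsStrictlyPositive.iff_of_unital]
    exact ⟨hε1, (isUnit_one.smul (Units.mk0 ε hε.ne'))⟩
  obtain ⟨u, hu⟩ := (CFC.isUnit_sqrt_iff G hG0).mpr hGu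
  set R : H →L[ℂ] H := ↑u⁻¹ with hR
  have hRQ : R * CFC.sqrt G = 1 := by rw [← hu]; exact u.inv_mul
  have hQR : CFC.sqrt G * R = 1 := by rw [← hu]; exact u.mul_inv
  have hRs : IsSelfAdjoint R := by
    have hus : IsSelfAdjoint u := by
      rw [IsSelfAdjoint, Units.ext_iff, Units.coe_star, hu]
      exact (IsSelfAdjoint.of_nonneg (CFC.sqrt_nonneg G)).star_eq
    have := hus.inv
    exact congrArg Units.val this.star_eq
  refine ⟨fun i => R * p i * R, fun i => hRs.conjugate_nonneg (hp i).nonneg, ?_, fun i => ?_⟩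
  · rw [← Finset.sum_mul, ← Finset.mul_sum]
    have h1 : R * G * R = 1 := by
      rw [← CFC.sqrt_mul_sqrt_self G hG0, ← mul_assoc, hRQ, one_mul, hQR]
    have h2 := hRs.conjugate_nonneg hε1
    rw [← h1, hG, mul_add, add_mul]
    exact le_add_of_nonneg_right h2
  · have h1 : G = p i + (∑ j ∈ Finset.univ.erase i, p j + ε • (1 : H →L[ℂ] H)) := by
      rw [← add_assoc, Finset.add_sum_erase _ _ (Finset.mem_univ i)]
    exact one_sub_conj_le (hp i) (add_nonneg (hsum _) hε1) hRs (h1 ▸ hRQ) (h1 ▸ hQR) hc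

end OperatorInequality

/-! ### Finitely supported averages and random selection -/

section Averages

variable {X : Type*}

/-- The mean of `f` under a finitely supported probability distribution. -/
def avg (P : Convexity.StdSimplex ℝ X) (f : X → ℝ) : ℝ := P.weights.sum fun x p => p * f x

lemma avg_eq_sum (P : Convexity.StdSimplex ℝ X) (f : X → ℝ) :
    avg P f = ∑ x ∈ P.weights.support, P.weights x * f x := rfl

lemma sum_weights (P : Convexity.StdSimplex ℝ X) : ∑ x ∈ P.weights.support, P.weights x = 1 :=
  P.total

lemma avg_const (P : Convexity.StdSimplex ℝ X) (a : ℝ) : avg P (fun _ => a) = a := by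
  rw [avg_eq_sum, ← Finset.sum_mul, sum_weights, one_mul]

lemma avg_add (P : Convexity.StdSimplex ℝ X) (f g : X → ℝ) :
    avg P (fun x => f x + g x) = avg P f + avg P g := by
  simp only [avg_eq_sum, mul_add, Finset.sum_add_distrib]

lemma avg_sub (P : Convexity.StdSimplex ℝ X) (f g : X → ℝ) :
    avg P (fun x => f x - g x) = avg P f - avg P g := by
  simp only [avg_eq_sum, mul_sub, Finset.sum_sub_distrib]

lemma avg_const_mul (P : Convexity.StdSimplex ℝ X) (a : ℝ) (f : X → ℝ) :
    avg P (fun x => a * f x) = a * avg P f := by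
  simp only [avg_eq_sum, Finset.mul_sum, mul_left_comm]

lemma avg_mono (P : Convexity.StdSimplex ℝ X) {f g : X → ℝ} (h : ∀ x, f x ≤ g x) :
    avg P f ≤ avg P g :=
  Finset.sum_le_sum fun x _ => mul_le_mul_of_nonneg_left (h x) (P.nonneg x)

lemma avg_nonneg (P : Convexity.StdSimplex ℝ X) {f : X → ℝ} (h : ∀ x, 0 ≤ f x) : 0 ≤ avg P f :=
  Finset.sum_nonneg fun x _ => mul_nonneg (P.nonneg x) (h x)

lemma avg_map {Y : Type*} (P : Convexity.StdSimplex ℝ Y) (g : Y → X) (f : X → ℝ) :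
    avg (P.map g) f = avg P (f ∘ g) := by
  rw [avg, Convexity.StdSimplex.weights_map, Finsupp.sum_mapDomain_index] <;>
    simp [avg, add_mul]

lemma avg_join (Q : Convexity.StdSimplex ℝ (Convexity.StdSimplex ℝ X)) (f : X → ℝ) :
    avg Q.join f = avg Q (fun P => avg P f) := by
  rw [avg, Convexity.StdSimplex.weights_join, Finsupp.sum_sum_index]
  · refine Finsupp.sum_congr fun P _ => ?_
    rw [Finsupp.sum_smul_index (by simp)]
    simp only [avg, Finsupp.mul_sum, mul_assoc]
  · simp
  · simp [add_mul]

variable {ι : Type*} [Fintype ι] [DecidableEq ι]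

/-- The law of a family of independent `P`-distributed variables. -/
def iidWeight (P : Convexity.StdSimplex ℝ X) (φ : ι → X) : ℝ := ∏ k, P.weights (φ k)

lemma sum_iidWeight_mul_mul (P : Convexity.StdSimplex ℝ X) (g h : X → ℝ) {i j : ι}
    (hij : i ≠ j) :
    ∑ φ ∈ Fintype.piFinset (fun _ : ι => P.weights.support),
      iidWeight P φ * (g (φ i) * h (φ j)) = avg P g * avg P h := by
  have key := Finset.prod_univ_sum (fun _ : ι => P.weights.support)
    (fun k x => P.weights x * ((if k = i then g x else 1) * (if k = j then h x else 1)))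
  have hr : ∀ k : ι, ∑ x ∈ P.weights.support,
      P.weights x * ((if k = i then g x else 1) * (if k = j then h x else 1)) =
      (if k = i then avg P g else 1) * (if k = j then avg P h else 1) := by
    intro k
    by_cases h1 : k = i
    · have h2 : k ≠ j := h1 ▸ hij
      simp [h1, hij, avg_eq_sum]
    · by_cases h2 : k = j <;> simp [h1, h2, hij.symm, avg_eq_sum, sum_weights]
  simp only [hr, Finset.prod_mul_distrib, Finset.prod_ite_eq', Finset.mem_univ, if_true] at key
  exact key.symm

lemma sum_iidWeight_mul (P : Convexity.StdSimplex ℝ X) (g : X → ℝ) (i : ι) :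
    ∑ φ ∈ Fintype.piFinset (fun _ : ι => P.weights.support),
      iidWeight P φ * g (φ i) = avg P g := by
  have key := Finset.prod_univ_sum (fun _ : ι => P.weights.support)
    (fun k x => P.weights x * (if k = i then g x else 1))
  have hr : ∀ k : ι, ∑ x ∈ P.weights.support, P.weights x * (if k = i then g x else 1) =
      if k = i then avg P g else 1 := by
    intro k
    by_cases h1 : k = i <;> simp [h1, avg_eq_sum, sum_weights]
  simp only [hr, Finset.prod_mul_distrib, Finset.prod_ite_eq', Finset.mem_univ, if_true] at key
  exact key.symm

lemma sum_iidWeight (P : Convexity.StdSimplex ℝ X) :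
    ∑ φ ∈ Fintype.piFinset (fun _ : ι => P.weights.support), iidWeight P φ = 1 := by
  have key := Finset.prod_univ_sum (fun _ : ι => P.weights.support) (fun _ x => P.weights x)
  simp only [sum_weights, Finset.prod_const_one] at key
  exact key.symm

/-- Expanding `b` in indicators of the value of `φ j` reduces the claim to products of functions of
independent coordinates. -/
lemma sum_iidWeight_mul_pair (P : Convexity.StdSimplex ℝ X) (b : X → X → ℝ) {i j : ι}
    (hij : i ≠ j) :
    ∑ φ ∈ Fintype.piFinset (fun _ : ι => P.weights.support), iidWeight P φ * b (φ i) (φ j) =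
      avg P fun y => avg P fun x => b x y := by
  classical
  have h1 : ∀ φ ∈ Fintype.piFinset (fun _ : ι => P.weights.support),
      iidWeight P φ * b (φ i) (φ j) = ∑ v ∈ P.weights.support,
        iidWeight P φ * (b (φ i) v * if φ j = v then 1 else 0) := by
    intro φ hφ
    rw [← Finset.mul_sum]
    simp only [mul_ite, mul_one, mul_zero]
    rw [Finset.sum_ite_eq, if_pos (Fintype.mem_piFinset.mp hφ j)]
  rw [Finset.sum_congr rfl h1, Finset.sum_comm, avg_eq_sum]
  refine Finset.sum_congr rfl fun v hv => ?_
  rw [sum_iidWeight_mul_mul P (fun x => b x v) (fun y => if y = v then 1 else 0) hij, mul_comm]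
  congr 1
  rw [avg_eq_sum]
  simp only [mul_ite, mul_one, mul_zero]
  rw [Finset.sum_ite_eq', if_pos hv]

/-- Random selection: some `N`-tuple does no worse than the i.i.d. average. -/
lemma exists_tuple_le (P : Convexity.StdSimplex ℝ X) (N : ℕ) (a : X → ℝ) (b : X → X → ℝ) :
    ∃ φ : Fin N → X, ∑ i, (a (φ i) + ∑ j ∈ Finset.univ.erase i, b (φ i) (φ j)) ≤
      N * (avg P a + (N - 1) * avg P fun y => avg P fun x => b x y) := by
  set F : (Fin N → X) → ℝ := fun φ =>
    ∑ i, (a (φ i) + ∑ j ∈ Finset.univ.erase i, b (φ i) (φ j)) with hF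
  set M : ℝ := N * (avg P a + (N - 1) * avg P fun y => avg P fun x => b x y) with hM
  have hE : ∑ φ ∈ Fintype.piFinset (fun _ : Fin N => P.weights.support),
      iidWeight P φ * F φ = M := by
    simp only [hF, Finset.mul_sum, mul_add, Finset.sum_add_distrib]
    rw [Finset.sum_comm, hM]
    have h1 : ∀ i : Fin N, ∑ j ∈ Finset.univ.erase i,
        ∑ φ ∈ Fintype.piFinset (fun _ : Fin N => P.weights.support),
          iidWeight P φ * b (φ i) (φ j) = (N - 1) * avg P fun y => avg P fun x => b x y := by
      intro i
      -- The index `i` itself gives `1 ≤ N`, so the cast of `N - 1` involves no truncation.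
      rw [Finset.sum_congr rfl fun j hj =>
        sum_iidWeight_mul_pair P b (Finset.ne_of_mem_erase hj).symm, Finset.sum_const,
        Finset.card_erase_of_mem (Finset.mem_univ i), Finset.card_univ, Fintype.card_fin,
        nsmul_eq_mul, Nat.cast_sub (Fin.pos i), Nat.cast_one]
    have h2 : ∑ φ ∈ Fintype.piFinset (fun _ : Fin N => P.weights.support),
        ∑ i, ∑ j ∈ Finset.univ.erase i, iidWeight P φ * b (φ i) (φ j) =
        N * ((N - 1) * avg P fun y => avg P fun x => b x y) := by
      rw [Finset.sum_comm]
      simp only [Finset.sum_comm (s := Fintype.piFinset _), h1, Finset.sum_const, Finset.card_univ,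
        Fintype.card_fin, nsmul_eq_mul]
    rw [h2]
    simp only [sum_iidWeight_mul, Finset.sum_const, Finset.card_univ, Fintype.card_fin,
      nsmul_eq_mul]
    ring
  by_contra! hc
  have hlt : ∑ φ ∈ Fintype.piFinset (fun _ : Fin N => P.weights.support), iidWeight P φ * M <
      ∑ φ ∈ Fintype.piFinset (fun _ : Fin N => P.weights.support), iidWeight P φ * F φ := by
    refine Finset.sum_lt_sum_of_nonempty
      (Fintype.piFinset_nonempty.mpr fun _ => P.support_weights_nonempty) fun φ hφ => ?_
    refine mul_lt_mul_of_pos_left (hc φ) (Finset.prod_pos fun k _ => ?_)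
    exact (P.nonneg _).lt_of_ne'
      (Finsupp.mem_support_iff.mp (Fintype.mem_piFinset.mp hφ k))
  rw [← Finset.sum_mul, sum_iidWeight, one_mul, hE] at hlt
  exact lt_irrefl _ hlt

end Averages

/-! ### One-shot converse and direct bounds -/

section Codes

variable {H : Type*} [NormedAddCommGroup H] [InnerProductSpace ℂ H] [CompleteSpace H]
  {X : Type*}

lemma spectralMass_eq_avg (W : Channel X H) (P : Convexity.StdSimplex ℝ X) (σ : State H) (t : ℝ) :
    spectralMass W P σ t =
      avg P fun x => (W x).expect (posProj ((W x).op - (t : ℂ) • σ.op)) := rfl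

lemma expect_mixture_eq_avg (W : Channel X H) (P : Convexity.StdSimplex ℝ X) (B : H →L[ℂ] H) :
    (mixture W P).expect B = avg P fun x => (W x).expect B :=
  State.expect_mixture W P B

lemma spectralMass_nonneg (W : Channel X H) (P : Convexity.StdSimplex ℝ X) (σ : State H)
    (t : ℝ) : 0 ≤ spectralMass W P σ t :=
  avg_nonneg P fun x => (W x).expect_nonneg (posProj_nonneg _)

lemma spectralMass_le_one (W : Channel X H) (P : Convexity.StdSimplex ℝ X) (σ : State H)
    (t : ℝ) : spectralMass W P σ t ≤ 1 :=
  (avg_mono P fun x => (W x).expect_le_one (posProj_le_one _)).trans_eq (avg_const P 1)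

namespace Code

variable {W : Channel X H}

lemma dec_nonneg (Φ : Code W) (i : Fin Φ.size) : 0 ≤ Φ.dec i :=
  (ContinuousLinearMap.nonneg_iff_isPositive _).mpr (Φ.dec_isPositive i)

lemma dec_le_one (Φ : Code W) (i : Fin Φ.size) : Φ.dec i ≤ 1 :=
  (Finset.single_le_sum (fun j _ => Φ.dec_nonneg j) (Finset.mem_univ i)).trans Φ.sum_dec_le

lemma size_pos' (Φ : Code W) : (0 : ℝ) < Φ.size := Nat.cast_pos.mpr Φ.size_pos

lemma errorProb_eq (Φ : Code W) :
    Φ.errorProb = (1 / (Φ.size : ℝ)) * ∑ i, (1 - (W (Φ.enc i)).expect (Φ.dec i)) := rfl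

lemma errorProb_nonneg (Φ : Code W) : 0 ≤ Φ.errorProb := by
  rw [errorProb_eq]
  refine mul_nonneg (by positivity) (Finset.sum_nonneg fun i _ => sub_nonneg.mpr ?_)
  exact (W _).expect_le_one (Φ.dec_le_one i)

lemma one_sub_errorProb (Φ : Code W) :
    1 - Φ.errorProb = (1 / (Φ.size : ℝ)) * ∑ i, (W (Φ.enc i)).expect (Φ.dec i) := by
  have := Φ.size_pos'.ne'
  rw [errorProb_eq, Finset.sum_sub_distrib, Finset.sum_const, Finset.card_univ, Fintype.card_fin,
    nsmul_eq_mul]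
  field_simp
  ring

lemma errorProb_le_one (Φ : Code W) : Φ.errorProb ≤ 1 := by
  rw [← sub_nonneg, one_sub_errorProb]
  exact mul_nonneg (by positivity) (Finset.sum_nonneg fun i _ =>
    (W _).expect_nonneg (Φ.dec_nonneg i))

/-- The code with a single codeword. -/
def trivial (W : Channel X H) (x : X) : Code W where
  size := 1
  size_pos := one_pos
  enc _ := x
  dec _ := 1
  dec_isPositive _ := ContinuousLinearMap.isPositive_one
  sum_dec_le := by simp

lemma trivial_errorProb (W : Channel X H) (x : X) : (trivial W x).errorProb = 0 := by
  rw [errorProb_eq]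
  have : ∀ i, (W ((trivial W x).enc i)).expect ((trivial W x).dec i) = 1 :=
    fun _ => State.expect_one _
  simp [this]

end Code

/-- The uniform distribution on `Fin n`. -/
def uniformFin (n : ℕ) (hn : 0 < n) : Convexity.StdSimplex ℝ (Fin n) where
  weights := Finsupp.equivFunOnFinite.symm fun _ => 1 / (n : ℝ)
  nonneg i := by simp
  total := by
    have : (n : ℝ) ≠ 0 := by positivity
    rw [Finsupp.sum_fintype _ _ (by simp)]
    simp [this]

lemma avg_uniformFin (n : ℕ) (hn : 0 < n) (f : Fin n → ℝ) :
    avg (uniformFin n hn) f = (1 / (n : ℝ)) * ∑ i, f i := by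
  rw [avg, Finsupp.sum_fintype _ _ (by simp), Finset.mul_sum]
  rfl

/-- The empirical distribution of the codewords. -/
def Code.law {W : Channel X H} (Φ : Code W) : Convexity.StdSimplex ℝ X :=
  (uniformFin Φ.size Φ.size_pos).map Φ.enc

/-- The converse bound. -/
lemma Code.one_sub_errorProb_le {W : Channel X H} (Φ : Code W) (σ : State H) {t : ℝ}
    (ht : 0 ≤ t) : 1 - Φ.errorProb ≤ spectralMass W Φ.law σ t + t / Φ.size := by
  rw [spectralMass_eq_avg, Code.law, avg_map, avg_uniformFin, one_sub_errorProb]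
  have h1 : ∀ i, (W (Φ.enc i)).expect (Φ.dec i) ≤ (W (Φ.enc i)).expect
      (posProj ((W (Φ.enc i)).op - (t : ℂ) • σ.op)) + t * σ.expect (Φ.dec i) := by
    intro i
    have h := (W (Φ.enc i)).expect_sub_le_posProj σ t (Φ.dec_nonneg i) (Φ.dec_le_one i)
    have h2 := mul_nonneg ht (σ.expect_nonneg (posProj_nonneg ((W (Φ.enc i)).op - (t : ℂ) • σ.op)))
    linarith
  have h2 : ∑ i, σ.expect (Φ.dec i) ≤ 1 := by
    rw [← State.expect_sum]
    exact σ.expect_le_one Φ.sum_dec_le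
  -- The reference state is the same for all codewords, so the penalties add up to at most `t`.
  have h3 := Finset.sum_le_sum fun i (_ : i ∈ Finset.univ) => h1 i
  rw [Finset.sum_add_distrib, ← Finset.mul_sum] at h3
  have h4 := mul_le_mul_of_nonneg_left h2 ht
  calc _ ≤ (1 / (Φ.size : ℝ)) * (∑ i, (W (Φ.enc i)).expect
        (posProj ((W (Φ.enc i)).op - (t : ℂ) • σ.op)) + t * 1) := by
        gcongr
        linarith
    _ = _ := by
        simp only [Function.comp]
        ring

/-- The direct bound, by random coding with a square-root measurement. -/
lemma exists_code (W : Channel X H) (P : Convexity.StdSimplex ℝ X) {N : ℕ} (hN : 0 < N)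
    {t c ε : ℝ} (ht : 0 < t) (hc : 0 < c) (hε : 0 < ε) :
    ∃ Φ : Code W, Φ.size = N ∧ Φ.errorProb ≤
      (1 + c) * (1 - spectralMass W P (mixture W P) t) + (2 + c + c⁻¹) * ((N - 1) / t + ε) := by
  set σ := mixture W P with hσ
  set p : X → H →L[ℂ] H := fun x => posProj ((W x).op - (t : ℂ) • σ.op) with hp
  have hK : 0 ≤ 2 + c + c⁻¹ := by positivity
  obtain ⟨φ, hφ⟩ := exists_tuple_le P N
    (fun x => (1 + c) * (1 - (W x).expect (p x)) + (2 + c + c⁻¹) * ε)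
    (fun x y => (2 + c + c⁻¹) * (W x).expect (p y))
  obtain ⟨Y, hY0, hY1, hY⟩ := exists_decoder (fun i => p (φ i))
    (fun i => isStarProjection_posProj _) hc hε
  refine ⟨⟨N, hN, φ, Y, fun i => (ContinuousLinearMap.nonneg_iff_isPositive _).mp (hY0 i), hY1⟩,
    rfl, ?_⟩
  have hN' : (0 : ℝ) < N := Nat.cast_pos.mpr hN
  -- Averaging over the independent sent letter gives the state `W_P`. Optimality against the zero
  -- test gives `t Tr[W_P p_y] ≤ Tr[W_y p_y] ≤ 1`.
  have hmass : avg P (fun y => avg P fun x => (2 + c + c⁻¹) * (W x).expect (p y)) ≤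
      (2 + c + c⁻¹) * (1 / t) := by
    simp only [avg_const_mul]
    refine mul_le_mul_of_nonneg_left ?_ hK
    rw [← avg_const P (1 / t)]
    refine avg_mono P fun y => ?_
    rw [← expect_mixture_eq_avg, le_div_iff₀' ht]
    have h := (W y).expect_sub_le_posProj σ t le_rfl zero_le_one
    rw [State.expect_zero, State.expect_zero, mul_zero, sub_zero] at h
    have := (W y).expect_le_one (posProj_le_one ((W y).op - (t : ℂ) • σ.op))
    linarith
  have hterm : ∀ i, 1 - (W (φ i)).expect (Y i) ≤
      (1 + c) * (1 - (W (φ i)).expect (p (φ i))) + (2 + c + c⁻¹) * ε +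
        ∑ j ∈ Finset.univ.erase i, (2 + c + c⁻¹) * (W (φ i)).expect (p (φ j)) := by
    intro i
    have h := (W (φ i)).expect_mono (hY i)
    simp only [State.expect_add, State.expect_sub, State.expect_real_smul, State.expect_one,
      State.expect_sum] at h
    rw [← Finset.mul_sum]
    linarith
  have hN1 : (0 : ℝ) ≤ N - 1 := sub_nonneg.mpr (by exact_mod_cast hN)
  rw [Code.errorProb_eq, one_div, inv_mul_le_iff₀ hN']
  refine (Finset.sum_le_sum fun i _ => hterm i).trans (hφ.trans ?_)
  refine mul_le_mul_of_nonneg_left ?_ hN'.le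
  rw [avg_add, avg_const_mul, avg_sub, avg_const, avg_const, spectralMass_eq_avg]
  have := mul_le_mul_of_nonneg_left hmass hN1
  calc _ ≤ _ := add_le_add_right this _
    _ = _ := by ring

/-- Comparison of spectral masses for reference states with `c σ' ≤ σ` in the weak sense. -/
lemma mul_spectralMass_le (W : Channel X H) (P : Convexity.StdSimplex ℝ X) {σ σ' : State H}
    {c s t : ℝ} (hc : 0 < c) (hs : 0 ≤ s) (ht : 0 < t)
    (h : ∀ B : H →L[ℂ] H, 0 ≤ B → c * σ'.expect B ≤ σ.expect B) :
    (1 - s / (c * t)) * spectralMass W P σ t ≤ spectralMass W P σ' s := by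
  rw [spectralMass_eq_avg, spectralMass_eq_avg, ← avg_const_mul]
  refine avg_mono P fun x => ?_
  set S := posProj ((W x).op - (t : ℂ) • σ.op) with hS
  set S' := posProj ((W x).op - (s : ℂ) • σ'.op) with hS'
  -- The test `S` built for `(σ, t)` competes in the problem `(σ', s)`; its cost there is controlled
  -- by `σ'(S) ≤ σ(S) / c ≤ W_x(S) / (c t)`.
  have h1 := (W x).expect_sub_le_posProj σ' s (posProj_nonneg _ : 0 ≤ S) (posProj_le_one _)
  have h2 := mul_nonneg hs (σ'.expect_nonneg (posProj_nonneg _ : 0 ≤ S'))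
  have h3 := (W x).expect_sub_le_posProj σ t le_rfl zero_le_one
  rw [State.expect_zero, State.expect_zero, mul_zero, sub_zero, ← hS] at h3
  have h4 : σ'.expect S ≤ (W x).expect S / (c * t) := by
    rw [le_div_iff₀ (by positivity)]
    have := mul_le_mul_of_nonneg_left (h S (posProj_nonneg _)) ht.le
    linarith
  have h5 := mul_le_mul_of_nonneg_left h4 hs
  have h6 : s * ((W x).expect S / (c * t)) = s / (c * t) * (W x).expect S := by ring
  rw [← hS'] at h1
  linarith

/-- The spectral mass decreases in the threshold. -/
lemma spectralMass_antitone (W : Channel X H) (P : Convexity.StdSimplex ℝ X) (σ : State H)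
    {s t : ℝ} (hs : 0 ≤ s) (hst : s ≤ t) : spectralMass W P σ t ≤ spectralMass W P σ s := by
  rw [spectralMass_eq_avg, spectralMass_eq_avg]
  refine avg_mono P fun x => ?_
  rcases hst.eq_or_lt with rfl | hlt
  · exact le_rfl
  set S := posProj ((W x).op - (t : ℂ) • σ.op) with hS
  set S' := posProj ((W x).op - (s : ℂ) • σ.op) with hS'
  have h1 := (W x).expect_sub_le_posProj σ s (posProj_nonneg _ : 0 ≤ S) (posProj_le_one _)
  have h2 := (W x).expect_sub_le_posProj σ t (posProj_nonneg _ : 0 ≤ S') (posProj_le_one _)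
  rw [← hS'] at h1
  rw [← hS] at h2
  -- Adding the two optimality inequalities gives `(t - s) (σ(S') - σ(S)) ≥ 0`.
  have h3 : σ.expect S ≤ σ.expect S' := by
    by_contra! hlt'
    nlinarith [mul_pos (sub_pos.mpr hlt) (sub_pos.mpr hlt')]
  nlinarith [mul_le_mul_of_nonneg_left h3 hs]

end Codes

/-! ### Exponential limits and diagonal sequences -/

section Asymptotics

lemma tendsto_pnat_coe_real : Tendsto (fun n : ℕ+ => ((n : ℕ) : ℝ)) atTop atTop :=
  tendsto_natCast_atTop_atTop.comp tendsto_PNat_val_atTop_atTop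

lemma tendsto_exp_pnat_mul {d : ℝ} (hd : d < 0) :
    Tendsto (fun n : ℕ+ => Real.exp (((n : ℕ) : ℝ) * d)) atTop (𝓝 0) :=
  Real.tendsto_exp_atBot.comp (tendsto_pnat_coe_real.atTop_mul_const_of_neg hd)

lemma tendsto_pnat_mul_exp {d : ℝ} (hd : d < 0) :
    Tendsto (fun n : ℕ+ => ((n : ℕ) : ℝ) * Real.exp (((n : ℕ) : ℝ) * d)) atTop (𝓝 0) := by
  have h1 : Tendsto (fun n : ℕ+ => ((n : ℕ) : ℝ) * -d) atTop atTop :=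
    tendsto_pnat_coe_real.atTop_mul_const (neg_pos.mpr hd)
  have h2 := ((Real.tendsto_pow_mul_exp_neg_atTop_nhds_zero 1).comp h1).mul_const (-d)⁻¹
  rw [zero_mul] at h2
  refine h2.congr fun n => ?_
  have : d ≠ 0 := hd.ne
  simp only [Function.comp, pow_one, mul_neg, neg_neg]
  field_simp

lemma tendsto_inv_pnat : Tendsto (fun n : ℕ+ => 1 / ((n : ℕ) : ℝ)) atTop (𝓝 0) := by
  simp only [one_div]
  exact tendsto_inv_atTop_zero.comp tendsto_pnat_coe_real

/-- `K n` is the largest `k ≤ n` with `p k n`. The search also returns 0 when it fails, so the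
property is claimed only once `K n ≥ 1`. -/
lemma exists_diagonal {p : ℕ → ℕ+ → Prop} (h : ∀ k, ∀ᶠ n in atTop, p k n) :
    ∃ K : ℕ+ → ℕ, Tendsto K atTop atTop ∧ ∀ᶠ n in atTop, p (K n) n := by
  classical
  have hK : Tendsto (fun n : ℕ+ => Nat.findGreatest (fun k => p k n) n) atTop atTop := by
    refine tendsto_atTop.mpr fun k => ?_
    filter_upwards [h k, eventually_ge_atTop (⟨k + 1, k.succ_pos⟩ : ℕ+)] with n hn hkn
    exact Nat.le_findGreatest ((Nat.le_succ k).trans hkn) hn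
  refine ⟨_, hK, ?_⟩
  filter_upwards [hK.eventually_ge_atTop 1] with n hn
  exact Nat.findGreatest_of_ne_zero (P := fun k => p k n) rfl (Nat.one_le_iff_ne_zero.mp hn)

end Asymptotics

/-! ### Mixing weights -/

section Weights

/-- Truncated geometric weights on `Fin n`. -/
def geomFin (n : ℕ) (hn : 0 < n) : Convexity.StdSimplex ℝ (Fin n) where
  weights := Finsupp.equivFunOnFinite.symm fun k =>
    (1 / 2 : ℝ) ^ ((k : ℕ) + 1) / ∑ j : Fin n, (1 / 2 : ℝ) ^ ((j : ℕ) + 1)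
  nonneg i := by
    simp only [Finsupp.coe_zero, Pi.zero_apply, Finsupp.equivFunOnFinite_symm_apply_apply]
    positivity
  total := by
    have : Nonempty (Fin n) := ⟨⟨0, hn⟩⟩
    have h : 0 < ∑ j : Fin n, (1 / 2 : ℝ) ^ ((j : ℕ) + 1) :=
      Finset.sum_pos (fun _ _ => by positivity) Finset.univ_nonempty
    rw [Finsupp.sum_fintype _ _ (by simp)]
    simp only [Finsupp.equivFunOnFinite_symm_apply_apply]
    rw [← Finset.sum_div, div_self h.ne']

lemma sum_half_pow_le (n : ℕ) : ∑ j : Fin n, (1 / 2 : ℝ) ^ ((j : ℕ) + 1) ≤ 1 := by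
  rw [Fin.sum_univ_eq_sum_range (fun j => (1 / 2 : ℝ) ^ (j + 1))]
  have h : ∑ j ∈ Finset.range n, (1 / 2 : ℝ) ^ (j + 1) = 1 - (1 / 2) ^ n := by
    induction n with
    | zero => simp
    | succ n ih => rw [Finset.sum_range_succ, ih]; ring
  rw [h]
  linarith [show (0 : ℝ) ≤ (1 / 2) ^ n by positivity]

/-- The lower bound on the `k`-th weight does not depend on `n`, so a mass that stays away from zero
in one component does so in the mixture. -/
lemma mul_le_avg_geomFin {n : ℕ} (hn : 0 < n) {f : Fin n → ℝ} (hf : ∀ i, 0 ≤ f i) (k : Fin n) :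
    (1 / 2 : ℝ) ^ ((k : ℕ) + 1) * f k ≤ avg (geomFin n hn) f := by
  have h1 : avg (geomFin n hn) f = ∑ i : Fin n,
      (1 / 2 : ℝ) ^ ((i : ℕ) + 1) / (∑ j : Fin n, (1 / 2 : ℝ) ^ ((j : ℕ) + 1)) * f i := by
    rw [avg, Finsupp.sum_fintype _ _ (by simp)]
    rfl
  have : Nonempty (Fin n) := ⟨k⟩
  have h : 0 < ∑ j : Fin n, (1 / 2 : ℝ) ^ ((j : ℕ) + 1) :=
    Finset.sum_pos (fun _ _ => by positivity) Finset.univ_nonempty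
  rw [h1]
  refine le_trans ?_ (Finset.single_le_sum (fun i _ => mul_nonneg (by positivity) (hf i))
    (Finset.mem_univ k))
  refine mul_le_mul_of_nonneg_right ?_ (hf k)
  rw [le_div_iff₀ h]
  exact mul_le_of_le_one_right (by positivity) (sum_half_pow_le n)

lemma avg_uniformFin_ge {n : ℕ} (hn : 0 < n) {f : Fin n → ℝ} (hf : ∀ i, 0 ≤ f i) (k : Fin n) :
    1 / (n : ℝ) * f k ≤ avg (uniformFin n hn) f := by
  rw [avg_uniformFin]
  gcongr
  exact Finset.single_le_sum (fun i _ => hf i) (Finset.mem_univ k)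

end Weights

/-! ### Spectral rates, capacities and attainment -/

section Sequences

variable {X : ℕ+ → Type*} {H : ℕ+ → Type*} [∀ n, NormedAddCommGroup (H n)]
  [∀ n, InnerProductSpace ℂ (H n)] [∀ n, CompleteSpace (H n)]

/-- The spectral mass at the exponential threshold `e^{na}`. -/
def mass (W : ∀ n, Channel (X n) (H n)) (P : ∀ n, Convexity.StdSimplex ℝ (X n))
    (σ : ∀ n, State (H n)) (a : ℝ) (n : ℕ+) : ℝ :=
  spectralMass (W n) (P n) (σ n) (Real.exp (((n : ℕ) : ℝ) * a))

variable {W : ∀ n, Channel (X n) (H n)} {P : ∀ n, Convexity.StdSimplex ℝ (X n)}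
  {σ σ' : ∀ n, State (H n)}

lemma mass_nonneg (a : ℝ) (n : ℕ+) : 0 ≤ mass W P σ a n := spectralMass_nonneg _ _ _ _

lemma mass_le_one (a : ℝ) (n : ℕ+) : mass W P σ a n ≤ 1 := spectralMass_le_one _ _ _ _

lemma mass_antitone {a b : ℝ} (h : a ≤ b) (n : ℕ+) : mass W P σ b n ≤ mass W P σ a n :=
  spectralMass_antitone _ _ _ (Real.exp_pos _).le (by gcongr)

lemma coe_le_infJ {a : ℝ} (h : Tendsto (mass W P σ a) atTop (𝓝 1)) : (a : EReal) ≤ infJ P σ W :=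
  le_sSup ⟨a, h, rfl⟩

lemma supJ_le_coe {a : ℝ} (h : Tendsto (mass W P σ a) atTop (𝓝 0)) : supJ P σ W ≤ (a : EReal) :=
  sInf_le ⟨a, h, rfl⟩

/-- If the mass at `a` does not vanish asymptotically, then `a ≤ J̅`. -/
lemma coe_le_supJ {a : ℝ} (h : ¬ Tendsto (mass W P σ a) atTop (𝓝 0)) :
    (a : EReal) ≤ supJ P σ W := by
  refine le_sInf ?_
  rintro _ ⟨b, hb, rfl⟩
  rw [EReal.coe_le_coe_iff]
  by_contra! hba
  exact h (squeeze_zero (mass_nonneg a) (mass_antitone hba.le) hb)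

/-- The one-shot comparison with constant `1/n`; for `b < a` the prefactor tends to 1. -/
lemma eventually_le_mass {a b : ℝ}
    (h : ∀ᶠ n : ℕ+ in atTop, ∀ B : H n →L[ℂ] H n, 0 ≤ B →
      1 / ((n : ℕ) : ℝ) * (σ' n).expect B ≤ (σ n).expect B) :
    ∀ᶠ n : ℕ+ in atTop, (1 - ((n : ℕ) : ℝ) * Real.exp (((n : ℕ) : ℝ) * (b - a))) * mass W P σ a n ≤
      mass W P σ' b n := by
  filter_upwards [h] with n hn
  have hn0 : (0 : ℝ) < (n : ℕ) := Nat.cast_pos.mpr n.pos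
  have h1 := mul_spectralMass_le (W n) (P n) (one_div_pos.mpr hn0)
    (Real.exp_pos (((n : ℕ) : ℝ) * b)).le (Real.exp_pos (((n : ℕ) : ℝ) * a)) hn
  have h2 : Real.exp (((n : ℕ) : ℝ) * b) / (1 / ((n : ℕ) : ℝ) * Real.exp (((n : ℕ) : ℝ) * a)) =
      ((n : ℕ) : ℝ) * Real.exp (((n : ℕ) : ℝ) * (b - a)) := by
    rw [mul_sub, Real.exp_sub]
    field_simp
  rwa [h2] at h1

lemma infJ_mono (h : ∀ᶠ n : ℕ+ in atTop, ∀ B : H n →L[ℂ] H n, 0 ≤ B →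
      1 / ((n : ℕ) : ℝ) * (σ' n).expect B ≤ (σ n).expect B) :
    infJ P σ W ≤ infJ P σ' W := by
  refine sSup_le ?_
  rintro _ ⟨a, ha, rfl⟩
  refine EReal.ge_of_forall_gt_iff_ge.mp fun b hb => ?_
  have hb' : b < a := EReal.coe_lt_coe_iff.mp hb
  refine coe_le_infJ ?_
  have h1 := ((tendsto_pnat_mul_exp (sub_neg.mpr hb')).const_sub 1).mul ha
  rw [sub_zero, one_mul] at h1
  exact tendsto_of_tendsto_of_tendsto_of_le_of_le' h1 tendsto_const_nhds (eventually_le_mass h)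
    (Eventually.of_forall fun n => mass_le_one b n)

lemma supJ_mono (h : ∀ᶠ n : ℕ+ in atTop, ∀ B : H n →L[ℂ] H n, 0 ≤ B →
      1 / ((n : ℕ) : ℝ) * (σ' n).expect B ≤ (σ n).expect B) :
    supJ P σ W ≤ supJ P σ' W := by
  refine le_sInf ?_
  rintro _ ⟨b, hb, rfl⟩
  refine EReal.le_of_forall_lt_iff_le.mp fun a ha => ?_
  have ha' : b < a := EReal.coe_lt_coe_iff.mp ha
  refine supJ_le_coe ?_
  -- The prefactor is eventually above `1/2`, hence the factor 2 in the bound.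
  have h1 := (tendsto_pnat_mul_exp (sub_neg.mpr ha')).eventually_lt_const
    (show (0 : ℝ) < 1 / 2 by norm_num)
  have h2 := Tendsto.const_mul 2 hb
  rw [mul_zero] at h2
  refine squeeze_zero' (Eventually.of_forall (mass_nonneg a)) ?_ h2
  filter_upwards [h1, eventually_le_mass h] with n hn1 hn2
  change _ ≤ 2 * mass W P σ' b n
  nlinarith [mass_nonneg (W := W) (P := P) (σ := σ) a n]

lemma exists_dominating_state (τ : ℕ → ∀ n, State (H n)) :
    ∃ σ : ∀ n, State (H n), ∀ k, ∀ᶠ n : ℕ+ in atTop, ∀ B : H n →L[ℂ] H n, 0 ≤ B →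
      1 / ((n : ℕ) : ℝ) * (τ k n).expect B ≤ (σ n).expect B := by
  refine ⟨fun n => mixture (fun j : Fin n => τ j n) (uniformFin n n.pos), fun k => ?_⟩
  filter_upwards [eventually_ge_atTop (⟨k + 1, k.succ_pos⟩ : ℕ+)] with n hn B hB
  rw [expect_mixture_eq_avg]
  exact avg_uniformFin_ge n.pos (f := fun j : Fin n => (τ j n).expect B)
    (fun j => (τ j n).expect_nonneg hB) ⟨k, hn⟩

/-- A functional of `σ` that decreases under domination attains its infimum. -/
lemma isLeast_iInf_of_mono [Nonempty (∀ n, State (H n))] (J : (∀ n, State (H n)) → EReal)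
    (hJ : ∀ σ σ' : ∀ n, State (H n), (∀ᶠ n : ℕ+ in atTop, ∀ B : H n →L[ℂ] H n, 0 ≤ B →
      1 / ((n : ℕ) : ℝ) * (σ' n).expect B ≤ (σ n).expect B) → J σ ≤ J σ') :
    IsLeast (Set.range J) (⨅ σ, J σ) := by
  obtain ⟨u, -, hu, hmem⟩ := exists_seq_tendsto_sInf (Set.range_nonempty J) (OrderBot.bddBelow _)
  choose τ hτ using hmem
  obtain ⟨σ, hσ⟩ := exists_dominating_state τ
  refine ⟨⟨σ, le_antisymm ?_ (iInf_le _ _)⟩, ?_⟩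
  · refine ge_of_tendsto' hu fun k => ?_
    rw [← hτ k]
    exact hJ _ _ (hσ k)
  · rintro _ ⟨σ', rfl⟩
    exact iInf_le _ _

lemma tendsto_exp_div_size {Φ : ∀ n, Code (W n)} {a : ℝ} (h : (a : EReal) < codeRate Φ) :
    Tendsto (fun n : ℕ+ => Real.exp (((n : ℕ) : ℝ) * a) / (Φ n).size) atTop (𝓝 0) := by
  obtain ⟨b, hab, hb⟩ := EReal.lt_iff_exists_real_btwn.mp h
  have hab' : a < b := EReal.coe_lt_coe_iff.mp hab
  refine squeeze_zero' (Eventually.of_forall fun n => by positivity) ?_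
    (tendsto_exp_pnat_mul (sub_neg.mpr hab'))
  filter_upwards [eventually_lt_of_lt_liminf hb] with n hn
  have hn0 : (0 : ℝ) < (n : ℕ) := Nat.cast_pos.mpr n.pos
  have h1 : b < 1 / ((n : ℕ) : ℝ) * Real.log (Φ n).size := EReal.coe_lt_coe_iff.mp hn
  rw [one_div, lt_inv_mul_iff₀ hn0, Real.lt_log_iff_exp_lt (Φ n).size_pos'] at h1
  rw [mul_sub, Real.exp_sub]
  gcongr

/-- The law of reliable codes bounds `J̲` below by the rate, for every reference state. -/
lemma codeRate_le_infJ {Φ : ∀ n, Code (W n)}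
    (h : Tendsto (fun n => (Φ n).errorProb) atTop (𝓝 0)) (σ : ∀ n, State (H n)) :
    codeRate Φ ≤ infJ (fun n => (Φ n).law) σ W := by
  refine EReal.ge_of_forall_gt_iff_ge.mp fun a ha => coe_le_infJ ?_
  have h1 := (h.const_sub 1).sub (tendsto_exp_div_size ha)
  rw [sub_zero, sub_zero] at h1
  refine tendsto_of_tendsto_of_tendsto_of_le_of_le h1 tendsto_const_nhds (fun n => ?_)
    (fun n => mass_le_one a n)
  exact sub_le_iff_le_add.mpr ((Φ n).one_sub_errorProb_le (σ n) (Real.exp_pos _).le)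

/-- Codes whose error probability does not tend to one keep the mass of their law away
from zero, for every reference state. -/
lemma not_tendsto_mass_law {Φ : ∀ n, Code (W n)}
    (h : ¬ Tendsto (fun n => (Φ n).errorProb) atTop (𝓝 1)) (σ : ∀ n, State (H n)) {a : ℝ}
    (ha : (a : EReal) < codeRate Φ) :
    ¬ Tendsto (mass W (fun n => (Φ n).law) σ a) atTop (𝓝 0) := by
  intro hm
  refine h ?_
  have h1 := hm.add (tendsto_exp_div_size ha)
  rw [add_zero] at h1
  have h2 : Tendsto (fun n => 1 - (Φ n).errorProb) atTop (𝓝 0) :=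
    squeeze_zero (fun n => sub_nonneg.mpr (Φ n).errorProb_le_one)
      (fun n => (Φ n).one_sub_errorProb_le (σ n) (Real.exp_pos _).le) h1
  simpa using h2.const_sub 1

/-- Codes of rate `z < a` whose error is controlled by the mass at `a`. -/
lemma exists_codes (W : ∀ n, Channel (X n) (H n)) (P : ∀ n, Convexity.StdSimplex ℝ (X n))
    {z a c : ℝ} (hza : z < a) (hc : 0 < c) :
    ∃ (Φ : ∀ n, Code (W n)) (δ : ℕ+ → ℝ), (z : EReal) ≤ codeRate Φ ∧ Tendsto δ atTop (𝓝 0) ∧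
      ∀ n, (Φ n).errorProb ≤
        (1 + c) * (1 - mass W P (fun n => mixture (W n) (P n)) a n) + δ n := by
  have hex : ∀ n : ℕ+, ∃ Φ : Code (W n), Φ.size = ⌈Real.exp (((n : ℕ) : ℝ) * z)⌉₊ ∧ _ :=
    fun n => exists_code (W n) (P n) (Nat.ceil_pos.mpr (Real.exp_pos (((n : ℕ) : ℝ) * z)))
      (Real.exp_pos (((n : ℕ) : ℝ) * a)) hc (one_div_pos.mpr (Nat.cast_pos.mpr n.pos))
  choose Φ hsize herr using hex
  refine ⟨Φ, fun n => (2 + c + c⁻¹) *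
    (Real.exp (((n : ℕ) : ℝ) * (z - a)) + 1 / ((n : ℕ) : ℝ)), ?_, ?_, fun n => ?_⟩
  · refine le_liminf_of_le (by isBoundedDefault) (Eventually.of_forall fun n => ?_)
    have hn0 : (0 : ℝ) < (n : ℕ) := Nat.cast_pos.mpr n.pos
    rw [EReal.coe_le_coe_iff, one_div, le_inv_mul_iff₀ hn0,
      Real.le_log_iff_exp_le (Φ n).size_pos', hsize]
    exact Nat.le_ceil _
  · simpa using ((tendsto_exp_pnat_mul (sub_neg.mpr hza)).add tendsto_inv_pnat).const_mul
      (2 + c + c⁻¹)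
  · refine (herr n).trans (add_le_add le_rfl (mul_le_mul_of_nonneg_left ?_ (by positivity)))
    refine add_le_add ?_ le_rfl
    rw [mul_sub, Real.exp_sub]
    -- Rounding up costs less than 1, which the `N - 1` of the direct bound absorbs.
    have := (Nat.ceil_lt_add_one (Real.exp_pos (((n : ℕ) : ℝ) * z)).le).le
    gcongr
    linarith

lemma infI_le_capacity (W : ∀ n, Channel (X n) (H n)) (P : ∀ n, Convexity.StdSimplex ℝ (X n)) :
    infI P W ≤ capacity W := by
  refine sSup_le ?_
  rintro _ ⟨a, ha, rfl⟩
  refine EReal.ge_of_forall_gt_iff_ge.mp fun z hz => ?_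
  obtain ⟨Φ, δ, hrate, hδ, herr⟩ := exists_codes W P (EReal.coe_lt_coe_iff.mp hz) one_pos
  refine le_sSup ⟨z, ⟨Φ, hrate, ?_⟩, rfl⟩
  have h1 := ((Tendsto.const_sub 1 ha).const_mul (1 + 1)).add hδ
  rw [sub_self, mul_zero, zero_add] at h1
  exact squeeze_zero (fun n => (Φ n).errorProb_nonneg) herr h1

lemma supI_le_dualCapacity (W : ∀ n, Channel (X n) (H n))
    (P : ∀ n, Convexity.StdSimplex ℝ (X n)) : supI P W ≤ dualCapacity W := by
  refine le_sInf ?_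
  rintro _ ⟨R, hR, rfl⟩
  refine EReal.le_of_forall_lt_iff_le.mp fun a ha => supJ_le_coe ?_
  refine tendsto_order.mpr ⟨fun y hy => Eventually.of_forall fun n => hy.trans_le (mass_nonneg a n),
    fun c hc => ?_⟩
  -- The tolerance `c` also serves as the coding parameter: once the error minus `δ` exceeds `1 -
  -- c²`, `(1 + c) * mass < c + c²`, so the mass is below `c`.
  obtain ⟨Φ, δ, hrate, hδ, herr⟩ := exists_codes W P (EReal.coe_lt_coe_iff.mp ha) hc
  have h1 := (hR Φ hrate).sub hδ
  rw [sub_zero] at h1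
  have hlt : 1 - c ^ 2 < 1 := by nlinarith
  filter_upwards [h1.eventually_const_lt hlt] with n hn
  have := herr n
  have h2 : (1 + c) * mass W P (fun n => mixture (W n) (P n)) a n < (1 + c) * c := by nlinarith
  exact lt_of_mul_lt_mul_left h2 (by linarith)

/-- Codes for rates approaching the supremum are spliced along a slowly growing index; the one-word
code shows that the set of rates is nonempty. -/
lemma exists_codes_capacity_le [∀ n, Nonempty (X n)] (W : ∀ n, Channel (X n) (H n)) :
    ∃ Φ : ∀ n, Code (W n), capacity W ≤ codeRate Φ ∧
      Tendsto (fun n => (Φ n).errorProb) atTop (𝓝 0) := by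
  have hne : ((fun R : ℝ => (R : EReal)) '' {R : ℝ | ∃ Φ : ∀ n, Code (W n),
      (R : EReal) ≤ codeRate Φ ∧ Tendsto (fun n => (Φ n).errorProb) atTop (𝓝 0)}).Nonempty := by
    refine ⟨_, 0, ⟨fun n => Code.trivial (W n) (Classical.arbitrary _), ?_, ?_⟩, rfl⟩
    · refine le_liminf_of_le (by isBoundedDefault) (Eventually.of_forall fun n => ?_)
      rw [EReal.coe_le_coe_iff]
      exact mul_nonneg (by positivity) (Real.log_natCast_nonneg _)
    · simp only [Code.trivial_errorProb]
      exact tendsto_const_nhds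
  obtain ⟨u, -, hu, hmem⟩ := exists_seq_tendsto_sSup hne (OrderTop.bddAbove _)
  choose R hR hRu using hmem
  choose Φ hrate herr using hR
  have hp : ∀ k : ℕ, ∀ᶠ n : ℕ+ in atTop,
      R k - 1 / ((k : ℝ) + 1) < 1 / ((n : ℕ) : ℝ) * Real.log ((Φ k n).size : ℝ) ∧
        (Φ k n).errorProb < 1 / ((k : ℝ) + 1) := by
    intro k
    have hk : (0 : ℝ) < 1 / ((k : ℝ) + 1) := by positivity
    have h1 : ((R k - 1 / ((k : ℝ) + 1) : ℝ) : EReal) < codeRate (Φ k) :=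
      (EReal.coe_lt_coe_iff.mpr (sub_lt_self _ hk)).trans_le (hrate k)
    filter_upwards [eventually_lt_of_lt_liminf h1, (herr k).eventually_lt_const hk] with n h2 h3
    exact ⟨EReal.coe_lt_coe_iff.mp h2, h3⟩
  obtain ⟨K, hK, hKp⟩ := exists_diagonal hp
  have hK0 : Tendsto (fun n => 1 / ((K n : ℝ) + 1)) atTop (𝓝 0) :=
    tendsto_one_div_add_atTop_nhds_zero_nat.comp hK
  refine ⟨fun n => Φ (K n) n, ?_, ?_⟩
  · refine EReal.ge_of_forall_gt_iff_ge.mp fun a ha => ?_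
    obtain ⟨b, hab, hb⟩ := EReal.lt_iff_exists_real_btwn.mp ha
    have hab' : a < b := EReal.coe_lt_coe_iff.mp hab
    refine le_liminf_of_le (by isBoundedDefault) ?_
    filter_upwards [hKp, (hu.comp hK).eventually_const_lt hb,
      hK0.eventually_lt_const (sub_pos.mpr hab')] with n h1 h2 h3
    rw [Function.comp, ← hRu, EReal.coe_lt_coe_iff] at h2
    rw [EReal.coe_le_coe_iff]
    linarith [h1.1]
  · exact squeeze_zero' (Eventually.of_forall fun n => (Φ (K n) n).errorProb_nonneg)
      (hKp.mono fun n h => h.2.le) hK0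

/-- Each rational below `C†` fails the defining condition, so some codes of at least that rate have
error not tending to 1. Their laws work for every `σ` at once, and one mixture treats all rationals
together. -/
lemma exists_dualCapacity_le_supJ [∀ n, Nonempty (X n)] (W : ∀ n, Channel (X n) (H n)) :
    ∃ P : ∀ n, Convexity.StdSimplex ℝ (X n), ∀ σ : ∀ n, State (H n),
      dualCapacity W ≤ supJ P σ W := by
  have hq : ∀ q : ℚ, ∃ P : ∀ n, Convexity.StdSimplex ℝ (X n),
      ((q : ℝ) : EReal) < dualCapacity W → ∀ (σ : ∀ n, State (H n)) (a : ℝ), a < q →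
        ¬ Tendsto (mass W P σ a) atTop (𝓝 0) := by
    intro q
    by_cases hqD : ((q : ℝ) : EReal) < dualCapacity W
    · have hnot : ¬ ∀ Φ : ∀ n, Code (W n), ((q : ℝ) : EReal) ≤ codeRate Φ →
          Tendsto (fun n => (Φ n).errorProb) atTop (𝓝 1) := fun h =>
        absurd hqD (not_lt.mpr (sInf_le ⟨(q : ℝ), h, rfl⟩))
      push Not at hnot
      obtain ⟨Φ, hrate, herr⟩ := hnot
      exact ⟨fun n => (Φ n).law, fun _ σ a ha =>
        not_tendsto_mass_law herr σ ((EReal.coe_lt_coe_iff.mpr ha).trans_le hrate)⟩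
    · exact ⟨fun n => .single (Classical.arbitrary _), fun h => absurd h hqD⟩
  choose Q hQ using hq
  obtain ⟨r, hr⟩ := exists_surjective_nat ℚ
  let P : ∀ n, Convexity.StdSimplex ℝ (X n) := fun n =>
    ((geomFin n n.pos).map fun k : Fin n => Q (r k) n).join
  have hP : ∀ (k : ℕ) (σ : ∀ n, State (H n)) (a : ℝ), ∀ᶠ n : ℕ+ in atTop,
      (1 / 2 : ℝ) ^ (k + 1) * mass W (Q (r k)) σ a n ≤ mass W P σ a n := by
    intro k σ a
    filter_upwards [eventually_ge_atTop (⟨k + 1, k.succ_pos⟩ : ℕ+)] with n hn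
    have h1 : mass W P σ a n = avg (geomFin n n.pos) fun j : Fin n => mass W (Q (r j)) σ a n := by
      rw [mass, spectralMass_eq_avg, avg_join, avg_map]
      rfl
    rw [h1]
    exact mul_le_avg_geomFin n.pos (f := fun j : Fin n => mass W (Q (r j)) σ a n)
      (fun j => mass_nonneg a n) ⟨k, hn⟩
  refine ⟨P, fun σ => EReal.ge_of_forall_gt_iff_ge.mp fun a ha => coe_le_supJ fun hm => ?_⟩
  obtain ⟨q, haq, hqD⟩ := EReal.lt_iff_exists_rat_btwn.mp ha
  obtain ⟨k, rfl⟩ := hr q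
  refine hQ (r k) hqD σ a (EReal.coe_lt_coe_iff.mp haq) ?_
  have h1 := hm.const_mul ((1 / 2 : ℝ) ^ (k + 1))⁻¹
  rw [mul_zero] at h1
  refine squeeze_zero' (Eventually.of_forall (mass_nonneg a)) ?_ h1
  filter_upwards [hP k σ a] with n hn
  rwa [le_inv_mul_iff₀ (by positivity)]

end Sequences

end CQ

end

/-- The quantum Verdú–Han formulas. `IsGreatest (Set.range f) c` says that `c` is the attained
maximum of `f`, and `IsLeast (Set.range f) c` that `c` is its attained minimum. -/
theorem theorem1 {X : ℕ+ → Type*} {H : ℕ+ → Type*} [∀ n, Nonempty (X n)]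
    [∀ n, NormedAddCommGroup (H n)] [∀ n, InnerProductSpace ℂ (H n)] [∀ n, CompleteSpace (H n)]
    (W : ∀ n, CQ.Channel (X n) (H n)) :
    (IsGreatest
        (Set.range fun P : ∀ n, Convexity.StdSimplex ℝ (X n) => CQ.infI P W) (CQ.capacity W) ∧
      (∀ P : ∀ n, Convexity.StdSimplex ℝ (X n),
        IsLeast (Set.range fun σ : ∀ n, CQ.State (H n) => CQ.infJ P σ W)
          (⨅ σ : ∀ n, CQ.State (H n), CQ.infJ P σ W)) ∧
      IsGreatest
        (Set.range fun P : ∀ n, Convexity.StdSimplex ℝ (X n) =>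
          ⨅ σ : ∀ n, CQ.State (H n), CQ.infJ P σ W) (CQ.capacity W)) ∧
    (IsGreatest
        (Set.range fun P : ∀ n, Convexity.StdSimplex ℝ (X n) => CQ.supI P W)
        (CQ.dualCapacity W) ∧
      (∀ P : ∀ n, Convexity.StdSimplex ℝ (X n),
        IsLeast (Set.range fun σ : ∀ n, CQ.State (H n) => CQ.supJ P σ W)
          (⨅ σ : ∀ n, CQ.State (H n), CQ.supJ P σ W)) ∧
      IsGreatest
        (Set.range fun P : ∀ n, Convexity.StdSimplex ℝ (X n) =>
          ⨅ σ : ∀ n, CQ.State (H n), CQ.supJ P σ W) (CQ.dualCapacity W)) := by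
  have hσ : Nonempty (∀ n, CQ.State (H n)) := ⟨fun n => W n (Classical.arbitrary _)⟩
  obtain ⟨Φ, hΦ, herr⟩ := CQ.exists_codes_capacity_le W
  obtain ⟨P, hP⟩ := CQ.exists_dualCapacity_le_supJ W
  have hinf : ∀ P : ∀ n, Convexity.StdSimplex ℝ (X n),
      ⨅ σ : ∀ n, CQ.State (H n), CQ.infJ P σ W ≤ CQ.infI P W := fun P => iInf_le _ _
  have hsup : ∀ P : ∀ n, Convexity.StdSimplex ℝ (X n),
      ⨅ σ : ∀ n, CQ.State (H n), CQ.supJ P σ W ≤ CQ.supI P W := fun P => iInf_le _ _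
  have hcap : CQ.capacity W ≤
      ⨅ σ : ∀ n, CQ.State (H n), CQ.infJ (fun n => (Φ n).law) σ W :=
    le_iInf fun σ => hΦ.trans (CQ.codeRate_le_infJ herr σ)
  have hdual : CQ.dualCapacity W ≤ ⨅ σ : ∀ n, CQ.State (H n), CQ.supJ P σ W := le_iInf hP
  refine ⟨⟨⟨⟨fun n => (Φ n).law, ?_⟩, ?_⟩, fun P => ?_, ⟨fun n => (Φ n).law, ?_⟩, ?_⟩,
    ⟨⟨P, ?_⟩, ?_⟩, fun P => ?_, ⟨P, ?_⟩, ?_⟩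
  · exact le_antisymm (CQ.infI_le_capacity W _) (hcap.trans (hinf _))
  · rintro _ ⟨P, rfl⟩
    exact CQ.infI_le_capacity W P
  · exact CQ.isLeast_iInf_of_mono _ fun σ σ' h => CQ.infJ_mono h
  · exact le_antisymm ((hinf _).trans (CQ.infI_le_capacity W _)) hcap
  · rintro _ ⟨P, rfl⟩
    exact (hinf P).trans (CQ.infI_le_capacity W P)
  · exact le_antisymm (CQ.supI_le_dualCapacity W _) (hdual.trans (hsup _))
  · rintro _ ⟨P, rfl⟩
    exact CQ.supI_le_dualCapacity W P
  · exact CQ.isLeast_iInf_of_mono _ fun σ σ' h => CQ.supJ_mono h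
  · exact le_antisymm ((hsup _).trans (CQ.supI_le_dualCapacity W _)) hdual
  · rintro _ ⟨P, rfl⟩
    exact (hsup P).trans (CQ.supI_le_dualCapacity W P)
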